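/- **Conventions.** $\mathrm{AC}(t(n))$ denotes logarithmic-time uniform families of Boolean circuits $(C_n)_n$ with NOT gates and unbounded fan-in AND and OR gates, of size $n^{O(1)}$ and depth $O(t(n))$. Uniformity means that a Turing machine, given $n$ and the binary names ($O(\log n)$ bits) of two gates of $C_n$, determines the type of the first gate and whether the second is wired to it in time linear in the number of bits given. $\mathrm{AC}^0=\mathrm{AC}(1)$. A *randomized dynamic $\mathrm{AC}^0$ algorithm for the abelian Cayley group membership problem* works on an $n$-element abelian group $G$ and an initial generating set $S_0\subseteq G$, as follows. A memory of polynomially many bits (in $n$) is initialized once from the multiplication table of $G$ and from $S_0$ by an $\mathrm{AC}(\log n)$ circuit. At each time step $t$, a set $I_t\subseteq G$ of insertions and a set $D_t\subseteq G$ of deletions arrive, the generating set becomes $S_{t+1}=(S_t\cup I_t)\setminus D_t$, and the memory is updated by an $\mathrm{AC}^0$ circuit from its old contents, $I_t$ and $D_t$. At every time a membership query $g\in G$ is answered by an $\mathrm{AC}^0$ circuit that takes the memory, $g$ and polynomially many independent uniform random bits as input. **Theorem.** For every constant $c$ there is a randomized dynamic $\mathrm{AC}^0$ algorithm for abelian Cayley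 group membership that supports $c\lfloor\log_2 n\rfloor^c+c$ insertions and as many deletions at each step: for every abelian group $G$ with $n$ elements, every $S_0\subseteq G$, all sequences $(I_t)$, $(D_t)$ of subsets of $G$ with $|I_t|,|D_t|\le c\lfloor\log_2 n\rfloor^c+c$ for all $t$, and every time $t\ge 0$, with probability at least $1-e^{-n}$ over the random bits, the answers to all the queries "is $g\in\langle S_t\rangle$?", $g\in G$, at time $t$ are correct. -/

import Mathlib

namespace DynCGM

/-! ### Boolean circuits of unbounded fan-in -/

/-- The kinds of gates of a Boolean circuit. -/
inductive GateKind
  | input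
  | not
  | and
  | or

/-- A Boolean circuit with unbounded fan-in AND and OR gates, unary NOT gates and input gates.
The gates are the numbers `a < size`. If `a` is an input gate then `wire a i` says that `a` reads
the `i`-th input bit; otherwise `wire a b` says that the gate `b` feeds into the gate `a`.
An AND (OR) gate that nothing feeds into is the constant true (false).
`level` witnesses that the circuit is acyclic. -/
structure Circuit where
  size : ℕ
  kind : ℕ → GateKind
  wire : ℕ → ℕ → Bool
  level : ℕ → ℕ
  level_lt : ∀ a b, a < size → b < size → kind a ≠ GateKind.input → wire a b = true →
    level b < level a
  input_unary : ∀ a, a < size → kind a = GateKind.input → ∃! i, wire a i = true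
  not_unary : ∀ a, a < size → kind a = GateKind.not → ∃! b, b < size ∧ wire a b = true

/-- The gates that feed into the gate `a`. -/
def Circuit.Child (C : Circuit) (a b : ℕ) : Prop :=
  a < C.size ∧ b < C.size ∧ C.wire a b = true

/-- The value of the gate `a` on the input bits `x`. -/
def Circuit.eval (C : Circuit) (x : ℕ → Prop) (a : ℕ) : Prop :=
  match _h : C.kind a with
  | GateKind.input => ∃ i, C.wire a i = true ∧ x i
  | GateKind.not => ∃ b : {b // C.Child a b}, ¬ C.eval x b.1
  | GateKind.and => ∀ b : {b // C.Child a b}, C.eval x b.1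
  | GateKind.or => ∃ b : {b // C.Child a b}, C.eval x b.1
termination_by C.level a
decreasing_by
  all_goals
    have hc := b.2
    exact C.level_lt a b.1 hc.1 hc.2.1 (by rw [_h]; intro hk; cases hk) hc.2.2

/-- The output bits of a circuit: output bit `i` is the value of the gate `i`. -/
def Circuit.output (C : Circuit) (x : ℕ → Prop) (i : ℕ) : Prop :=
  i < C.size ∧ C.eval x i

/-! ### Uniformity -/

/-- Three numbers written in binary (least significant bit first), with separators. -/
def encodeTriple (q : ℕ × ℕ × ℕ) : List (Option Bool) :=
  (Nat.bits q.1).map some ++ [none] ++ (Nat.bits q.2.1).map some ++ [none] ++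
    (Nat.bits q.2.2).map some

/-- Logarithmic-time uniformity of a family of circuits: some Turing machine (with a fixed finite
number of stacks), given `n` and two gate names `a`, `b` in binary, finds the kind of the gate `a`
of the `n`-th circuit and whether `b` is wired to `a`, in time linear in the number of bits that it
is given. As names of gates of a polynomial-size circuit have `O(log n)` bits, this is time
`O(log n)`. -/
def DLogTimeUniform (C : ℕ → Circuit) : Prop :=
  ∃ (M : Turing.TM2ComputableInTime encodeTriple
      (fun o : GateKind × Bool => [o])
      (fun q : ℕ × ℕ × ℕ => ((C q.1).kind q.2.1, (C q.1).wire q.2.1 q.2.2))) (K : ℕ),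
    ∀ l : ℕ, M.time l ≤ K * l + K

/-- `C` is a logarithmic-time uniform family of circuits of polynomial size and of depth `O(t n)`.
(Gates that are not needed may be left isolated, so prescribing the size `n ^ k + k` is no
restriction; it keeps the size from carrying information.) -/
def UniformAC (t : ℕ → ℕ) (C : ℕ → Circuit) : Prop :=
  DLogTimeUniform C ∧
    ∃ k : ℕ, ∀ n : ℕ, (C n).size = n ^ k + k ∧ ∀ a < (C n).size, (C n).level a ≤ k * t n + k

/-! ### Dynamic algorithms -/

/-- The bit string that interleaves three bit strings: bit `4 * j + s` is bit `j` of the `s`-th. -/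
def interleave (x y z : ℕ → Prop) (i : ℕ) : Prop :=
  (i % 4 = 0 ∧ x (i / 4)) ∨ (i % 4 = 1 ∧ y (i / 4)) ∨ (i % 4 = 2 ∧ z (i / 4))

/-- The multiplication table of `G` as a bit string: the bit whose address is the concatenation of
the binary representations of `x`, `y`, `z` tells whether `x * y = z` in `G`. -/
def tableBits {n : ℕ} (G : CommGroup (Fin n)) (i : ℕ) : Prop :=
  ∃ x y z : Fin n, i = x + 2 ^ Nat.size n * (y + 2 ^ Nat.size n * z) ∧ G.mul x y = z

/-- The characteristic bit string of a set of group elements. -/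
def setBits {n : ℕ} (S : Set (Fin n)) (i : ℕ) : Prop :=
  ∃ x ∈ S, (x : ℕ) = i

/-- A dynamic algorithm with random bits, given by three families of circuits: `init` computes the
first contents of the memory from the group and the initial generating set, `update` computes
the new contents of the memory from the old one and a set of insertions and deletions, and
`answer` answers a membership query from the memory, using `n ^ coins + coins` random bits. -/
structure DynAlgorithm where
  init : ℕ → Circuit
  update : ℕ → Circuit
  answer : ℕ → Circuit
  coins : ℕ

namespace DynAlgorithm

/-- The number of random bits used for answering a query. -/
def numCoins (A : DynAlgorithm) (n : ℕ) : ℕ := n ^ A.coins + A.coins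

/-- The contents of the memory after `t` steps, where step `t` (counted from `0`) inserts `I t` and
deletes `D t`. -/
def memory (A : DynAlgorithm) {n : ℕ} (G : CommGroup (Fin n)) (S₀ : Set (Fin n))
    (I D : ℕ → Set (Fin n)) : ℕ → ℕ → Prop
  | 0 => (A.init n).output (interleave (tableBits G) (setBits S₀) (fun _ => False))
  | t + 1 => (A.update n).output
      (interleave (A.memory G S₀ I D t) (setBits (I t)) (setBits (D t)))

/-- The answer to the query `g`, for the contents `m` of the memory and the random bits `r`. -/
def Accepts (A : DynAlgorithm) {n : ℕ} (m : ℕ → Prop) (g : Fin n)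
    (r : Fin (A.numCoins n) → Bool) : Prop :=
  (A.answer n).output
    (interleave m (setBits {g}) (fun i => ∃ h : i < A.numCoins n, r ⟨i, h⟩ = true)) 0

/-- A randomized dynamic `AC⁰` algorithm: updates and answers are computed by uniform `AC⁰`
circuits. The memory is set up once, by a uniform circuit family of depth `O(log n)`. -/
def IsDynAC0 (A : DynAlgorithm) : Prop :=
  UniformAC (fun n => Nat.log 2 n) A.init ∧
    UniformAC (fun _ => 1) A.update ∧ UniformAC (fun _ => 1) A.answer

end DynAlgorithm

/-- The generating set after `t` steps. -/
def genSet {n : ℕ} (S₀ : Set (Fin n)) (I D : ℕ → Set (Fin n)) : ℕ → Set (Fin n)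
  | 0 => S₀
  | t + 1 => (genSet S₀ I D t ∪ I t) \ D t

/-- The subgroup of `G` generated by `S`. -/
def generated {n : ℕ} (G : CommGroup (Fin n)) (S : Set (Fin n)) : Set (Fin n) :=
  (@Subgroup.closure (Fin n) G.toGroup S : Set (Fin n))

end DynCGM

/-!
The algorithm is deterministic, and so its answers are correct for every outcome of the random bits.
It rests on duality: an element `g` of a finite abelian group `G` lies in the subgroup generated by
`S` if and only if every character of `G` that is trivial on `S` is trivial at `g`. The characters
are `n` in number and do not depend on `S`. Hence the initialization tabulates the kernels of all
characters, an update changes only the stored set `S`, and a query asks whether every kernel that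
contains `S` contains `g`, which is a first-order question about the memory and so in `AC⁰`.

For the table, the characters have to be named by elements of `G` in a way that an `AC(log n)`
circuit can follow (`Naming`). The values of the characters are taken in the cyclic subgroup of `G`
generated by the least element whose order is the exponent of `G`. A chain of subgroups starts with
the trivial one, and `H` is followed by the subgroup generated by `H` and the least element `b`
outside of `H`; as the subgroups at least double in size, the chain reaches `G` within `log₂ n`
steps. If `h` names a character of `H`, then its extensions to the next subgroup differ by the powers
of a fixed root of unity of order `q`, the order of `b` modulo `H`, and the `q` cosets of `H` are
those of the powers of `b`. The extension that multiplies the least possible value at `b` by the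
`k`-th power of the root is named `h * t`, where `t` is the least element of the coset of `b ^ k`. So
the graphs of the characters of each subgroup are first-order definable from those of the previous
one (`Naming.NextR`), given the relation "`(y, w)` is a power of `(b, v)`", which is itself obtained
by doubling the exponents `log₂ n` times. An element that names no character still yields a set by
these definitions; where it is not a subgroup, it is replaced by `G`, so that no harm is done
(`Naming.mem_closure_iff`).

Uniformity is dealt with once and for all. A `Program` is a system of recursive first-order
definitions of relations between numbers below `2 ^ Nat.size n`, where the recursion is guided by
clocks whose value is halved at each tick. The gates of its circuits are the pairs of a subformula
and an assignment of numbers to the registers. Which gate feeds into which is then decided by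
comparing, digit by digit, the bits of two assignments, that is, by a finite automaton reading all
registers in parallel (`Automatic`), and a Turing machine can arrange the registers as parallel
tracks and run the automaton in linear time (`Scanner.exists_computableInTime`). This gives
logarithmic-time uniform circuits whose depth is proportional to the number of ticks
(`Program.exists_uniformAC`).
-/

namespace DynCGM

open Turing

/-! ### A machine that scans gate names in linear time -/

/-- One bit of each of the tracks read by the automaton: track `none` carries `n`, track
`some (false, i)` carries the `i`-th field of the gate `a` and `some (true, i)` that of `b`. -/
abbrev Letter (F : ℕ) := Option (Bool × Fin F) → Bool

/-- The word of the `s` low-order bits of the tracks `V`, least significant letter first. -/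
def word {F : ℕ} : ℕ → (Option (Bool × Fin F) → ℕ) → List (Letter F)
  | 0, _ => []
  | s + 1, V => (fun t => (V t).bodd) :: word s (fun t => V t / 2)

/-- Truncation of a natural number at `T`. -/
def sat (T m : ℕ) : Fin (T + 1) := ⟨min m T, by omega⟩

/-- The finite data of a machine that recognizes the wiring of a family of circuits. A gate number
consists of `F` fields of as many bits as `n` has, in the low-order positions, and a tag above them.
The number `b` is read in the same way, except that it is an input position if the tag of `a` is
that of an input gate; then its two low-order bits select one of four input streams and only the
rest is cut into fields. The machine finds the tags, truncated at `T`, and runs the automaton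
`δ`, `q₀` on `n` and the fields of both numbers, which are read in parallel. The answer `out` depends on the
two tags, the two low-order bits and the final state; `isIn` tells the tags of input gates. -/
structure Scanner (F T : ℕ) where
  Q : Type
  finQ : Finite Q
  δ : Letter F → Q → Q
  q₀ : Q
  isIn : Fin (T + 1) → Bool
  out : Fin (T + 1) → Fin (T + 1) → Bool × Bool → Q → GateKind × Bool

namespace Scanner

/-- The tracks for `n` and the gate numbers `a` and `b`. Only the low-order `Nat.size n` bits of
each track are meant to be read. -/
def tracks (F n a b : ℕ) : Option (Bool × Fin F) → ℕ
  | none => n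
  | some (false, i) => a / 2 ^ (Nat.size n * i)
  | some (true, i) => b / 2 ^ (Nat.size n * i)

variable {F T : ℕ} (P : Scanner F T)

/-- The function computed by the machine. -/
def result (q : ℕ × ℕ × ℕ) : GateKind × Bool :=
  let n := q.1
  let a := q.2.1
  let s := Nat.size n
  let tA := sat T (a / 2 ^ (s * F))
  let b := if P.isIn tA then q.2.2 / 2 / 2 else q.2.2
  let low := if P.isIn tA then (q.2.2.bodd, (q.2.2 / 2).bodd) else (false, false)
  P.out tA (sat T (b / 2 ^ (s * F))) low (List.foldr P.δ P.q₀ (word s (tracks F n a b)))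

/-- The stacks of the machine: input, output, and two stacks of letters. -/
inductive Stk
  | inp
  | out
  | fwd
  | bwd
  deriving DecidableEq

instance : Fintype Stk := ⟨{.inp, .out, .fwd, .bwd}, by intro x; cases x <;> simp⟩

/-- The stack alphabets. -/
abbrev Γ (F : ℕ) : Stk → Type
  | .inp => Option Bool
  | .out => GateKind × Bool
  | .fwd => Letter F
  | .bwd => Letter F

/-- The labels of the machine. The side `sd` is `false` for the gate `a` and `true` for `b`. -/
inductive Lab (F : ℕ)
  /-- Turn the bits of `n` into letters on the backward stack. -/
  | readN
  /-- Move the letters from the backward to the forward stack. -/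
  | back (sd : Bool) (i : Fin (F + 1))
  /-- Move the letters from the forward to the backward stack while writing the next bits of the
  input on the track of field `i`; for `i = F`, read the tag. -/
  | fill (sd : Bool) (i : Fin (F + 1))
  /-- Remove one of the two low-order bits of an input position. -/
  | strip (second : Bool)
  /-- Move the letters to the backward stack, for the automaton to start with the most significant
  bits. -/
  | flip
  /-- Run the automaton on the letters of the backward stack. -/
  | auto

/-- The internal memory of the machine: the symbol just read from the input (`none` inside the
option for a separator), the letter just read from one of the stacks of letters, for both sides the
truncated tag as far as it has been read and the truncated weight of its next bit, the two low-order
bits of an input position, and the state of the automaton. -/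
structure Var (F T : ℕ) (Q : Type) where
  sym : Option (Option Bool)
  cur : Option (Letter F)
  val : Bool → Fin (T + 1)
  wt : Bool → Fin (T + 1)
  low : Bool × Bool
  q : Q

theorem finite_lab : Finite (Lab F) := by
  refine Finite.of_injective (β := Fin 6 × Bool × Fin (F + 1)) (fun l => match l with
    | .readN => (0, false, 0)
    | .back sd i => (1, sd, i)
    | .fill sd i => (2, sd, i)
    | .strip c => (3, c, 0)
    | .flip => (4, false, 0)
    | .auto => (5, false, 0)) ?_
  intro x y h
  cases x <;> cases y <;> simp_all

theorem finite_var {Q : Type} [Finite Q] : Finite (Var F T Q) := by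
  refine Finite.of_injective (fun v : Var F T Q => (v.sym, v.cur, v.val, v.wt, v.low, v.q)) ?_
  rintro ⟨⟩ ⟨⟩ h
  simp_all

/-- The internal memory between two steps, when nothing has just been read. -/
def var (val wt : Bool → Fin (T + 1)) (low : Bool × Bool) (q : P.Q) : Var F T P.Q :=
  ⟨none, none, val, wt, low, q⟩

/-- The initial memory. -/
def var₀ : Var F T P.Q := P.var (fun _ => sat T 0) (fun _ => sat T 1) (false, false) P.q₀

/-- Forget the symbols that were just read. -/
def Var.clear {Q : Type} (v : Var F T Q) : Var F T Q := { v with sym := none, cur := none }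

/-- The bit that was just read from the input stack, if any. -/
def Var.bit {Q : Type} (v : Var F T Q) : Bool :=
  match v.sym with
  | some (some b) => b
  | _ => false

/-- Whether a bit was just read from the input stack. -/
def Var.isBit {Q : Type} (v : Var F T Q) : Bool :=
  match v.sym with
  | some (some _) => true
  | _ => false

/-- The letter that was just read. -/
def Var.letter {Q : Type} (v : Var F T Q) : Letter F := v.cur.getD (fun _ => false)

/-- Take the bit that was just read into account in the gate type of side `sd`. -/
def Var.addTag {Q : Type} (sd : Bool) (v : Var F T Q) : Var F T Q :=
  { v with
    val := Function.update v.val sd (sat T (v.val sd + (if v.bit then (v.wt sd : ℕ) else 0)))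
    wt := Function.update v.wt sd (sat T (2 * v.wt sd)) }

open TM2.Stmt in
/-- The program of the machine. -/
def prog : Lab F → TM2.Stmt (Γ F) (Lab F) (Var F T P.Q)
  | .readN =>
    pop .inp (fun v o => { v with sym := o }) <|
    branch Var.isBit
      (push .bwd (fun v => fun t => if t = none then v.bit else false) <|
        load Var.clear <| goto fun _ => .readN)
      (load Var.clear <| goto fun _ => .back false 0)
  | .back sd i =>
    pop .bwd (fun v o => { v with cur := o }) <|
    branch (fun v => v.cur.isSome)
      (push .fwd Var.letter <| load Var.clear <| goto fun _ => .back sd i)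
      (load Var.clear <| goto fun _ => .fill sd i)
  | .fill sd i =>
    if h : i.1 < F then
      pop .fwd (fun v o => { v with cur := o }) <|
      branch (fun v => v.cur.isSome)
        (peek .inp (fun v o => { v with sym := o }) <|
          push .bwd (fun v => Function.update v.letter (some (sd, ⟨i, h⟩)) v.bit) <|
          branch Var.isBit
            (pop .inp (fun v _ => v) <| load Var.clear <| goto fun _ => .fill sd i)
            (load Var.clear <| goto fun _ => .fill sd i))
        (load Var.clear <| goto fun _ => .back sd ⟨i + 1, by omega⟩)
    else
      pop .inp (fun v o => { v with sym := o }) <|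
      branch Var.isBit
        (load (Var.addTag sd) <| load Var.clear <| goto fun _ => .fill sd i)
        (load Var.clear <| goto fun v =>
          if sd then .flip else if P.isIn (v.val false) then .strip false else .fill true 0)
  | .strip false =>
    pop .inp (fun v o => { v with sym := o }) <|
    load (fun v => Var.clear { v with low := (v.bit, v.low.2) }) <| goto fun _ => .strip true
  | .strip true =>
    pop .inp (fun v o => { v with sym := o }) <|
    load (fun v => Var.clear { v with low := (v.low.1, v.bit) }) <| goto fun _ => .fill true 0
  | .flip =>
    pop .fwd (fun v o => { v with cur := o }) <|
    branch (fun v => v.cur.isSome)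
      (push .bwd Var.letter <| load Var.clear <| goto fun _ => .flip)
      (load Var.clear <| goto fun _ => .auto)
  | .auto =>
    pop .bwd (fun v o => { v with cur := o }) <|
    branch (fun v => v.cur.isSome)
      (load (fun v => Var.clear { v with q := P.δ v.letter v.q }) <| goto fun _ => .auto)
      (push .out (fun v => P.out (v.val false) (v.val true) v.low v.q) <|
        load (fun _ => P.var₀) halt)

/-- The machine that recognizes the wiring. -/
noncomputable def machine : FinTM2 where
  K := Stk
  k₀ := .inp
  k₁ := .out
  Γ := Γ F
  Λ := Lab F
  main := .readN
  ΛFin := haveI := finite_lab (F := F); Fintype.ofFinite _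
  σ := Var F T P.Q
  initialState := P.var₀
  σFin := haveI := P.finQ; haveI := finite_var (F := F) (T := T) (Q := P.Q); Fintype.ofFinite _
  Γk₀Fin := inferInstanceAs (Fintype (Option Bool))
  m := P.prog

/-- The contents of the stacks. -/
def stks (i : List (Option Bool)) (o : List (GateKind × Bool)) (f b : List (Letter F)) :
    ∀ k, List (Γ F k)
  | .inp => i
  | .out => o
  | .fwd => f
  | .bwd => b

section
variable (i i' : List (Option Bool)) (o o' : List (GateKind × Bool)) (f f' b b' : List (Letter F))

@[simp] theorem stks_inp : stks i o f b .inp = i := rfl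
@[simp] theorem stks_out : stks i o f b .out = o := rfl
@[simp] theorem stks_fwd : stks i o f b .fwd = f := rfl
@[simp] theorem stks_bwd : stks i o f b .bwd = b := rfl

@[simp] theorem update_stks_inp : Function.update (stks i o f b) .inp i' = stks i' o f b := by
  funext k; cases k <;> simp [Function.update, stks]
@[simp] theorem update_stks_out : Function.update (stks i o f b) .out o' = stks i o' f b := by
  funext k; cases k <;> simp [Function.update, stks]
@[simp] theorem update_stks_fwd : Function.update (stks i o f b) .fwd f' = stks i o f' b := by
  funext k; cases k <;> simp [Function.update, stks]
@[simp] theorem update_stks_bwd : Function.update (stks i o f b) .bwd b' = stks i o f b' := by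
  funext k; cases k <;> simp [Function.update, stks]
end

/-- A configuration of the machine. -/
abbrev Conf := TM2.Cfg (Γ F) (Lab F) (Var F T P.Q)

/-- The machine gets from `c` to `c'` in `k` steps. -/
def Runs (c c' : P.Conf) (k : ℕ) : Prop :=
  (flip bind (TM2.step P.prog))^[k] (some c) = some c'

variable {P}

theorem Runs.trans {c₁ c₂ c₃ : P.Conf} {k l : ℕ} (h : P.Runs c₁ c₂ k) (h' : P.Runs c₂ c₃ l) :
    P.Runs c₁ c₃ (k + l) := by
  unfold Runs at *
  rw [Nat.add_comm, Function.iterate_add_apply, h, h']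

theorem Runs.step {c₁ c₂ : P.Conf} (h : TM2.step P.prog c₁ = some c₂) : P.Runs c₁ c₂ 1 := by
  simpa [Runs, flip] using h

theorem Runs.refl (c : P.Conf) : P.Runs c c 0 := rfl

theorem Runs.head {c₁ c₂ c₃ : P.Conf} {k : ℕ} (h : TM2.step P.prog c₁ = some c₂)
    (h' : P.Runs c₂ c₃ k) : P.Runs c₁ c₃ (k + 1) := by
  rw [Nat.add_comm]; exact (Runs.step h).trans h'

variable {val wt : Bool → Fin (T + 1)} {low : Bool × Bool} {q : P.Q}

theorem runs_back (sd : Bool) (i : Fin (F + 1)) (x : List (Option Bool)) (b f : List (Letter F)) :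
    P.Runs ⟨some (.back sd i), P.var val wt low q, stks x [] f b⟩
      ⟨some (.fill sd i), P.var val wt low q, stks x [] (b.reverse ++ f) []⟩ (b.length + 1) := by
  induction b generalizing f with
  | nil => exact Runs.step (by simp [prog, var, Var.clear])
  | cons l b ih =>
    refine Runs.head (c₂ := ⟨some (.back sd i), P.var val wt low q, stks x [] (l :: f) b⟩)
      (by simp [prog, var, Var.clear, Var.letter]) ?_
    simpa using ih (l :: f)

theorem runs_flip (x : List (Option Bool)) (b f : List (Letter F)) :
    P.Runs ⟨some .flip, P.var val wt low q, stks x [] f b⟩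
      ⟨some .auto, P.var val wt low q, stks x [] [] (f.reverse ++ b)⟩ (f.length + 1) := by
  induction f generalizing b with
  | nil => exact Runs.step (by simp [prog, var, Var.clear])
  | cons l f ih =>
    refine Runs.head (c₂ := ⟨some .flip, P.var val wt low q, stks x [] f (l :: b)⟩)
      (by simp [prog, var, Var.clear, Var.letter]) ?_
    simpa using ih (l :: b)

theorem runs_auto (b : List (Letter F)) :
    P.Runs ⟨some .auto, P.var val wt low q, stks [] [] [] b⟩
      ⟨none, P.var₀, stks [] [P.out (val false) (val true) low (b.foldl (fun q l => P.δ l q) q)]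
        [] []⟩ (b.length + 1) := by
  induction b generalizing q with
  | nil => exact Runs.step (by simp [prog, var])
  | cons l b ih =>
    refine Runs.head (c₂ := ⟨some .auto, P.var val wt low (P.δ l q), stks [] [] [] b⟩)
      (by simp [prog, var, Var.clear, Var.letter]) ?_
    simpa using ih (q := P.δ l q)

theorem runs_readN (x : List Bool) (r : List (Option Bool)) (b : List (Letter F)) :
    P.Runs ⟨some .readN, P.var val wt low q, stks (x.map some ++ none :: r) [] [] b⟩
      ⟨some (.back false 0), P.var val wt low q, stks r [] []
        ((x.map fun c t => if t = none then c else false).reverse ++ b)⟩ (x.length + 1) := by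
  induction x generalizing b with
  | nil => exact Runs.step (by simp [prog, var, Var.clear, Var.isBit])
  | cons c x ih =>
    refine Runs.head (c₂ := ⟨some .readN, P.var val wt low q, stks (x.map some ++ none :: r) [] []
      ((fun t => if t = none then c else false) :: b)⟩)
      (by simp [prog, var, Var.clear, Var.isBit, Var.bit]) ?_
    simpa using ih ((fun t => if t = none then c else false) :: b)

/-- Write the bits `x` on the track `t` of the letters. -/
def fillLetters (t : Option (Bool × Fin F)) : List (Letter F) → List Bool → List (Letter F)
  | [], _ => []
  | l :: L, x => Function.update l t (x.headD false) :: fillLetters t L x.tail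

/-- The part of the input that follows a number: nothing, or a separator and more. -/
def IsRest (r : List (Option Bool)) : Prop := r = [] ∨ ∃ r', r = none :: r'

theorem runs_fill (sd : Bool) (i : Fin F) (x : List Bool) {r : List (Option Bool)}
    (hr : IsRest r) (f b : List (Letter F)) :
    P.Runs ⟨some (.fill sd i.castSucc), P.var val wt low q, stks (x.map some ++ r) [] f b⟩
      ⟨some (.back sd i.succ), P.var val wt low q, stks ((x.drop f.length).map some ++ r) [] []
        ((fillLetters (some (sd, i)) f x).reverse ++ b)⟩ (f.length + 1) := by
  induction f generalizing x b with
  | nil =>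
    refine Runs.step ?_
    simp [prog, var, Var.clear, fillLetters, Fin.succ]
  | cons l f ih =>
    refine Runs.head (c₂ := ⟨some (.fill sd i.castSucc), P.var val wt low q,
      stks (x.tail.map some ++ r) [] f (Function.update l (some (sd, i)) (x.headD false) :: b)⟩)
      ?_ ?_
    · cases x with
      | nil =>
        rcases hr with rfl | ⟨r, rfl⟩ <;>
          simp [prog, var, Var.clear, Var.isBit, Var.bit, Var.letter]
      | cons c x => simp [prog, var, Var.clear, Var.isBit, Var.bit, Var.letter]
    · have := ih x.tail (Function.update l (some (sd, i)) (x.headD false) :: b)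
      simpa [fillLetters, List.drop_tail] using this

theorem length_word (s : ℕ) (V : Option (Bool × Fin F) → ℕ) : (word s V).length = s := by
  induction s generalizing V with
  | zero => rfl
  | succ s ih => simp [word, ih]

theorem bits_tail (m : ℕ) : m.bits.tail = (m / 2).bits := by
  rw [← Nat.div2_bits_eq_tail, Nat.div2_val]

theorem bits_headD (m : ℕ) : m.bits.headD false = m.bodd := by
  rw [Nat.bodd_eq_bits_head]
  cases m.bits <;> rfl

theorem bits_drop (m s : ℕ) : m.bits.drop s = (m / 2 ^ s).bits := by
  induction s generalizing m with
  | zero => simp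
  | succ s ih =>
    rw [← List.drop_tail, bits_tail, ih, Nat.div_div_eq_div_mul, pow_succ']

theorem fillLetters_word (t : Option (Bool × Fin F)) (s m : ℕ) (V : Option (Bool × Fin F) → ℕ) :
    fillLetters t (word s V) m.bits = word s (Function.update V t m) := by
  induction s generalizing V m with
  | zero => rfl
  | succ s ih =>
    rw [word, fillLetters, word, bits_tail, ih, bits_headD]
    congr 1
    · funext t'
      by_cases h : t' = t
      · subst h; simp
      · simp [h]
    · congr 1
      funext t'
      by_cases h : t' = t
      · subst h; simp
      · simp [h]

/-- The tracks after the fields below `i` of the number `m` have been written on side `sd`. -/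
def fillTracks (s : ℕ) (V : Option (Bool × Fin F) → ℕ) (sd : Bool) (m i : ℕ) :
    Option (Bool × Fin F) → ℕ
  | none => V none
  | some (sd', j) => if sd' = sd ∧ j.1 < i then m / 2 ^ (s * j) else V (some (sd', j))

theorem fillTracks_succ (s : ℕ) (V : Option (Bool × Fin F) → ℕ) (sd : Bool) (m : ℕ) (i : Fin F) :
    fillTracks s V sd m (i + 1) =
      Function.update (fillTracks s V sd m i) (some (sd, i)) (m / 2 ^ (s * i)) := by
  funext t
  match t with
  | none => simp [fillTracks]
  | some (sd', j) =>
    by_cases h : sd' = sd ∧ j = i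
    · obtain ⟨rfl, rfl⟩ := h; simp [fillTracks]
    · rw [Function.update_of_ne (by simpa using h)]
      have : (sd' = sd ∧ j.1 < i + 1) ↔ (sd' = sd ∧ j.1 < i) := by
        rw [Fin.ext_iff] at h; constructor <;> rintro ⟨h1, h2⟩ <;> refine ⟨h1, ?_⟩
        · have : j.1 ≠ i.1 := fun h3 => h ⟨h1, h3⟩
          omega
        · omega
      simp only [fillTracks, this]

theorem runs_fields (sd : Bool) (s m : ℕ) (V : Option (Bool × Fin F) → ℕ)
    {r : List (Option Bool)} (hr : IsRest r) (i : ℕ) (hi : i < F + 1) :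
    P.Runs ⟨some (.fill sd 0), P.var val wt low q, stks (m.bits.map some ++ r) [] (word s V) []⟩
      ⟨some (.fill sd ⟨i, hi⟩), P.var val wt low q, stks ((m / 2 ^ (s * i)).bits.map some ++ r) []
        (word s (fillTracks s V sd m i)) []⟩ (i * (2 * s + 2)) := by
  induction i with
  | zero =>
    have : fillTracks s V sd m 0 = V := by
      funext t; match t with
      | none => rfl
      | some (_, j) => simp [fillTracks]
    simp only [this, Nat.mul_zero, pow_zero, Nat.div_one, Nat.zero_mul]
    exact Runs.refl _
  | succ i ih =>
    have hi' : i < F := by omega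
    have h1 := runs_fill (P := P) (val := val) (wt := wt) (low := low) (q := q) sd ⟨i, hi'⟩
      (m / 2 ^ (s * i)).bits hr (word s (fillTracks s V sd m i)) []
    have h2 := runs_back (P := P) (val := val) (wt := wt) (low := low) (q := q) sd
      (Fin.succ ⟨i, hi'⟩) ((m / 2 ^ (s * (i + 1))).bits.map some ++ r)
      (word s (fillTracks s V sd m (i + 1))).reverse []
    rw [fillLetters_word, ← fillTracks_succ (i := ⟨i, hi'⟩), length_word, bits_drop,
      Nat.div_div_eq_div_mul, ← pow_add, ← Nat.mul_succ, List.append_nil] at h1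
    rw [List.reverse_reverse, List.length_reverse, length_word, List.append_nil] at h2
    have := ((ih (by omega)).trans h1).trans h2
    rwa [show i * (2 * s + 2) + (s + 1) + (s + 1) = (i + 1) * (2 * s + 2) by ring] at this

/-- The number with the given bits, least significant bit first. -/
def bitsVal (x : List Bool) : ℕ := x.foldr (fun c m => c.toNat + 2 * m) 0

theorem bitsVal_bits (m : ℕ) : bitsVal m.bits = m := by
  induction m using Nat.strong_induction_on with
  | _ m ih =>
    rcases Nat.eq_zero_or_pos m with rfl | hm
    · simp [bitsVal]
    · have h1 := bits_headD m
      have h2 := bits_tail m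
      have h3 := ih (m / 2) (by omega)
      cases h : m.bits with
      | nil =>
        rw [h] at h1 h2
        rw [← h2] at h3
        have := Nat.bodd_add_div2 m
        rw [← h1, Nat.div2_val, ← h3] at this
        simpa [bitsVal] using this
      | cons c x =>
        rw [h] at h1 h2
        simp only [List.headD_cons, List.tail_cons] at h1 h2
        rw [← h2, bitsVal] at h3
        simp only [bitsVal, List.foldr_cons, h3, h1]
        have := Nat.bodd_add_div2 m
        rw [Nat.div2_val] at this
        exact this

theorem sat_add_mul (v w c : ℕ) :
    sat T ((sat T v : ℕ) + (if c = 1 then (sat T w : ℕ) else 0)) =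
      sat T (v + if c = 1 then w else 0) := by
  ext; simp only [sat]; split_ifs <;> omega

theorem sat_two_mul (w : ℕ) : sat T (2 * (sat T w : ℕ)) = sat T (2 * w) := by
  ext; simp only [sat]; omega

/-- The label that follows the reading of the gate type of side `sd`. -/
def afterTag (P : Scanner F T) (sd : Bool) (t : Fin (T + 1)) : Lab F :=
  if sd then .flip else if P.isIn t then .strip false else .fill true 0

theorem runs_tag (sd : Bool) (x : List Bool) {r : List (Option Bool)} (hr : IsRest r)
    (f b : List (Letter F)) (v w : ℕ) (hv : val sd = sat T v) (hw : wt sd = sat T w) :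
    ∃ wt', (∀ sd', sd' ≠ sd → wt' sd' = wt sd') ∧
    P.Runs ⟨some (.fill sd (Fin.last F)), P.var val wt low q, stks (x.map some ++ r) [] f b⟩
      ⟨some (P.afterTag sd (Function.update val sd (sat T (v + w * bitsVal x)) false)),
        P.var (Function.update val sd (sat T (v + w * bitsVal x))) wt' low q,
        stks r.tail [] f b⟩ (x.length + 1) := by
  induction x generalizing val wt v w with
  | nil =>
    refine ⟨wt, fun _ _ => rfl, Runs.step ?_⟩
    have : Function.update val sd (sat T (v + w * bitsVal [])) = val := by
      simp [bitsVal, ← hv]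
    rw [this]
    rcases hr with rfl | ⟨r, rfl⟩ <;>
      simp [prog, var, Var.clear, Var.isBit, afterTag]
  | cons c x ih =>
    obtain ⟨wt', h1, h2⟩ := ih
      (val := Function.update val sd (sat T (v + if c.toNat = 1 then w else 0)))
      (wt := Function.update wt sd (sat T (2 * w)))
      (v + if c.toNat = 1 then w else 0) (2 * w) (by simp) (by simp)
    refine ⟨wt', fun sd' h => by rw [h1 sd' h, Function.update_of_ne h], Runs.head (c₂ :=
      ⟨some (.fill sd (Fin.last F)), P.var
        (Function.update val sd (sat T (v + if c.toNat = 1 then w else 0)))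
        (Function.update wt sd (sat T (2 * w))) low q, stks (x.map some ++ r) [] f b⟩) ?_ ?_⟩
    rotate_left 1
    · have e : v + (if c.toNat = 1 then w else 0) + 2 * w * bitsVal x =
          v + w * bitsVal (c :: x) := by
        cases c <;> simp [bitsVal] <;> ring
      rw [e, Function.update_idem] at h2
      exact h2
    · have e1 := sat_add_mul (T := T) v w c.toNat
      have e2 := sat_two_mul (T := T) w
      cases c <;>
        simp_all [prog, var, Var.clear, Var.isBit, Var.bit, Var.addTag]

theorem runs_strip (x : List Bool) (f : List (Letter F)) :
    P.Runs ⟨some (.strip false), P.var val wt low q, stks (x.map some) [] f []⟩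
      ⟨some (.fill true 0), P.var val wt (x.headD false, x.tail.headD false) q,
        stks (x.tail.tail.map some) [] f []⟩ 2 := by
  refine (Runs.step (c₂ := ⟨some (.strip true), P.var val wt (x.headD false, low.2) q,
    stks (x.tail.map some) [] f []⟩) ?_).trans (Runs.step ?_)
  · cases x <;> simp [prog, var, Var.clear, Var.bit]
  · cases x.tail <;> simp [prog, var, Var.clear, Var.bit]

theorem word_size (n : ℕ) :
    (n.bits.map fun c t => if t = none then c else false : List (Letter F)) =
      word (Nat.size n) (fun t => if t = none then n else 0) := by
  have key : ∀ (x : List Bool), (x.map fun c t => if t = none then c else false : List (Letter F)) =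
      word x.length (fun t => if t = none then bitsVal x else 0) := by
    intro x
    induction x with
    | nil => rfl
    | cons c x ih =>
      rw [List.map_cons, ih, List.length_cons, word]
      have h1 : (bitsVal (c :: x)).bodd = c := by cases c <;> simp [bitsVal]
      have h2 : bitsVal (c :: x) / 2 = bitsVal x := by
        cases c <;> simp only [bitsVal, List.foldr_cons, Bool.toNat_false, Bool.toNat_true] <;>
          omega
      congr 1
      · funext t; by_cases h : t = none <;> simp [h, h1]
      · congr 1; funext t; by_cases h : t = none <;> simp [h, h2]
  have := key n.bits
  rwa [bitsVal_bits, Nat.size_eq_bits_len] at this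

/-- The whole run of the machine. The letters are passed over twice for each of the `2 * F` fields,
so the time is linear, and the machine ends in its initial state with only the result on its
stacks. -/
theorem runs_main (n a b : ℕ) :
    ∃ k, k ≤ (4 * F + 12) * (encodeTriple (n, a, b)).length + (4 * F + 12) ∧
    P.Runs ⟨some .readN, P.var₀, stks (encodeTriple (n, a, b)) [] [] []⟩
      ⟨none, P.var₀, stks [] [P.result (n, a, b)] [] []⟩ k := by
  set s := Nat.size n with hs
  have hlen : (encodeTriple (n, a, b)).length = s + a.bits.length + b.bits.length + 2 := by
    simp [encodeTriple, Nat.size_eq_bits_len, hs]; omega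
  have henc : encodeTriple (n, a, b) =
      n.bits.map some ++ none :: (a.bits.map some ++ none :: b.bits.map some) := by
    simp [encodeTriple]
  set V₀ : Option (Bool × Fin F) → ℕ := fun t => if t = none then n else 0 with hV₀
  set V₁ := fillTracks s V₀ false a F with hV₁
  have hrest : IsRest (none :: b.bits.map some) := Or.inr ⟨_, rfl⟩
  have r1 := (runs_readN (P := P) (val := fun _ => sat T 0) (wt := fun _ => sat T 1)
    (low := (false, false)) (q := P.q₀) n.bits
    (a.bits.map some ++ none :: b.bits.map some) []).trans
    (runs_back false 0 _ _ [])
  rw [List.append_nil, List.append_nil, List.reverse_reverse, List.length_reverse, word_size,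
    length_word, ← hs, Nat.size_eq_bits_len, ← hs, ← henc] at r1
  have r2 := r1.trans (runs_fields false s a V₀ hrest F (Nat.lt_succ_self F))
  obtain ⟨wt₁, hwt₁, t1⟩ := runs_tag (P := P) (val := fun _ => sat T 0) (wt := fun _ => sat T 1)
    (low := (false, false)) (q := P.q₀) false (a / 2 ^ (s * F)).bits hrest (word s V₁) []
    0 1 rfl rfl
  have r3 := r2.trans t1
  rw [bitsVal_bits, zero_add, one_mul, Function.update_self, List.tail_cons] at r3
  set tA := sat T (a / 2 ^ (s * F)) with htA
  set val₁ : Bool → Fin (T + 1) := Function.update (fun _ => sat T 0) false tA with hval₁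
  -- reading the two low-order bits of `b`, if `a` is an input gate
  obtain ⟨k₄, hk₄, r4⟩ : ∃ k₄ ≤ 2, P.Runs
      ⟨some (P.afterTag false tA), P.var val₁ wt₁ (false, false) P.q₀,
        stks (b.bits.map some) [] (word s V₁) []⟩
      ⟨some (.fill true 0), P.var val₁ wt₁
        (if P.isIn tA then (b.bodd, (b / 2).bodd) else (false, false)) P.q₀,
        stks ((if P.isIn tA then b / 2 / 2 else b).bits.map some) [] (word s V₁) []⟩ k₄ := by
    by_cases h : P.isIn tA
    · refine ⟨2, le_rfl, ?_⟩
      have := runs_strip (P := P) (val := val₁) (wt := wt₁) (low := (false, false)) (q := P.q₀)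
        b.bits (word s V₁)
      simpa only [bits_tail, bits_headD, afterTag, h, if_true, Bool.false_eq_true, if_false]
        using this
    · refine ⟨0, by omega, ?_⟩
      simpa only [afterTag, h, Bool.false_eq_true, if_false] using Runs.refl _
  set b' := if P.isIn tA then b / 2 / 2 else b with hb'
  set low := if P.isIn tA then (b.bodd, (b / 2).bodd) else (false, false) with hlow
  have f2 := runs_fields (P := P) (val := val₁) (wt := wt₁) (low := low) (q := P.q₀) true s b' V₁
    (Or.inl rfl) F F.lt_succ_self
  rw [List.append_nil, List.append_nil] at f2
  have r5 := (r3.trans r4).trans f2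
  set V₂ := fillTracks s V₁ true b' F with hV₂
  obtain ⟨wt₂, -, t2⟩ := runs_tag (P := P) (val := val₁) (wt := wt₁)
    (low := low) (q := P.q₀) true (b' / 2 ^ (s * F)).bits (Or.inl rfl) (word s V₂) [] 0 1
    (by simp [hval₁]) (by rw [hwt₁ _ (by simp)])
  rw [bitsVal_bits, zero_add, one_mul, List.append_nil, List.tail_nil] at t2
  have r6 := ((r5.trans t2).trans (runs_flip _ _ _)).trans (runs_auto _)
  have hV : V₂ = tracks F n a b' := by
    funext t
    match t with
    | none => simp [hV₂, hV₁, hV₀, fillTracks, tracks]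
    | some (false, i) => simp [hV₂, hV₁, hV₀, fillTracks, tracks, hs]
    | some (true, i) => simp [hV₂, fillTracks, tracks, hs]
  have hres : P.out (Function.update val₁ true (sat T (b' / 2 ^ (s * F))) false)
      (Function.update val₁ true (sat T (b' / 2 ^ (s * F))) true) low
      (((word s V₂).reverse ++ []).foldl (fun q l => P.δ l q) P.q₀) = P.result (n, a, b) := by
    rw [List.append_nil, List.foldl_reverse, hV]
    simp [hval₁, result, hb', hlow, htA, hs]
  rw [hres] at r6
  refine ⟨_, ?_, r6⟩
  have l1 : ∀ m e : ℕ, (m / 2 ^ e).bits.length ≤ m.bits.length := by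
    intro m e; rw [← bits_drop]; simp
  have l2 : b'.bits.length ≤ b.bits.length := by
    rw [hb']; split_ifs
    · rw [← bits_tail, ← bits_tail]; simp; omega
    · rfl
  have l3 := l1 a (s * F)
  have l4 := (l1 b' (s * F)).trans l2
  rw [hlen]
  simp only [List.length_append, List.length_reverse, length_word, List.length_nil]
  have : (4 * F + 12) * (s + a.bits.length + b.bits.length + 2) =
    (4 * F + 12) * s + (4 * F + 12) * (a.bits.length + b.bits.length) + 2 * (4 * F + 12) := by ring
  have h5 : a.bits.length + b.bits.length ≤
    (4 * F + 12) * (a.bits.length + b.bits.length) := Nat.le_mul_of_pos_left _ (by omega)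
  have h6 : F * (2 * s + 2) = 2 * (F * s) + 2 * F := by ring
  have h7 : (4 * F + 12) * s = 4 * (F * s) + 12 * s := by ring
  omega

/-- The function recognized by a scanner is computable in linear time. -/
theorem exists_computableInTime (P : Scanner F T) :
    ∃ (M : TM2ComputableInTime encodeTriple (fun o : GateKind × Bool => [o]) P.result) (K : ℕ),
      ∀ l : ℕ, M.time l ≤ K * l + K := by
  have key := fun x : ℕ × ℕ × ℕ => runs_main (P := P) x.1 x.2.1 x.2.2
  choose k hk hrun using key
  refine ⟨{
    tm := P.machine
    inputAlphabet := Equiv.refl _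
    outputAlphabet := Equiv.refl _
    time := fun l => (4 * F + 12) * l + (4 * F + 12)
    outputsFun := fun x => ⟨⟨k x, ?_⟩, hk x⟩ }, 4 * F + 12, fun l => le_rfl⟩
  have h := hrun x
  have e1 : initList P.machine (List.map (Equiv.refl (Option Bool)).invFun (encodeTriple x)) =
      (⟨some .readN, P.var₀, stks (encodeTriple x) [] [] []⟩ : P.Conf) := by
    have hm : (List.map (Equiv.refl (Option Bool)).invFun (encodeTriple x) : List (Option Bool)) =
      encodeTriple x := List.map_id _
    refine (congrArg (initList P.machine) hm).trans ?_
    unfold initList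
    congr 1
    funext k
    cases k <;> rfl
  have e2 : haltList P.machine (List.map (Equiv.refl (GateKind × Bool)).invFun [P.result x]) =
      (⟨none, P.var₀, stks [] [P.result x] [] []⟩ : P.Conf) := by
    unfold haltList
    congr 1
    funext k
    cases k <;> rfl
  have e3 := e1 ▸ e2 ▸ h
  exact e3

end Scanner

/-! ### Automatic relations -/

/-- A relation between the tracks `V`, of `s` bits each, is automatic if a finite automaton
recognizes it by reading all the tracks simultaneously, most significant bits first. -/
def Automatic {F : ℕ} (R : ℕ → (Option (Bool × Fin F) → ℕ) → Prop) : Prop :=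
  ∃ (Q : Type) (_ : Finite Q) (δ : Letter F → Q → Q) (q₀ : Q) (acc : Q → Prop),
    ∀ s V, (∀ t, V t < 2 ^ s) → (R s V ↔ acc ((word s V).foldr δ q₀))

namespace Automatic

variable {F : ℕ} {R R' : ℕ → (Option (Bool × Fin F) → ℕ) → Prop}

theorem const (p : Prop) : Automatic (F := F) fun _ _ => p :=
  ⟨Unit, inferInstance, fun _ q => q, (), fun _ => p, fun _ _ _ => Iff.rfl⟩

/-- Finitely many automatic relations are recognized by a single automaton. -/
theorem simultaneously {ι : Type} [Finite ι] {R : ι → ℕ → (Option (Bool × Fin F) → ℕ) → Prop}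
    (h : ∀ i, Automatic (R i)) :
    ∃ (Q : Type) (_ : Finite Q) (δ : Letter F → Q → Q) (q₀ : Q) (acc : ι → Q → Prop),
      ∀ i s V, (∀ t, V t < 2 ^ s) → (R i s V ↔ acc i ((word s V).foldr δ q₀)) := by
  choose Q hQ δ q₀ acc hacc using h
  refine ⟨∀ i, Q i, inferInstance, fun l q i => δ i l (q i), q₀, fun i q => acc i (q i), ?_⟩
  intro i s V hV
  refine (hacc i s V hV).trans ?_
  have : ∀ w : List (Letter F), w.foldr (fun l q i => δ i l (q i)) q₀ i = w.foldr (δ i) (q₀ i) := by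
    intro w
    induction w with
    | nil => rfl
    | cons l w ih => simp [ih]
  simp only [this]

theorem forall_finite {ι : Type} [Finite ι] {R : ι → ℕ → (Option (Bool × Fin F) → ℕ) → Prop}
    (h : ∀ i, Automatic (R i)) : Automatic fun s V => ∀ i, R i s V := by
  obtain ⟨Q, hQ, δ, q₀, acc, hacc⟩ := simultaneously h
  exact ⟨Q, hQ, δ, q₀, fun q => ∀ i, acc i q, fun s V hV => forall_congr' fun i => hacc i s V hV⟩

theorem not (h : Automatic R) : Automatic fun s V => ¬ R s V := by
  obtain ⟨Q, hQ, δ, q₀, acc, hacc⟩ := h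
  exact ⟨Q, hQ, δ, q₀, fun q => ¬ acc q, fun s V hV => not_congr (hacc s V hV)⟩

theorem and (h : Automatic R) (h' : Automatic R') : Automatic fun s V => R s V ∧ R' s V := by
  obtain ⟨Q, hQ, δ, q₀, acc, hacc⟩ := simultaneously (ι := Bool)
    (R := fun b => if b then R else R') (by intro b; cases b <;> assumption)
  exact ⟨Q, hQ, δ, q₀, fun q => acc true q ∧ acc false q, fun s V hV =>
    and_congr (hacc true s V hV) (hacc false s V hV)⟩

theorem congr (h : Automatic R) (e : ∀ s V, (∀ t, V t < 2 ^ s) → (R' s V ↔ R s V)) :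
    Automatic R' := by
  obtain ⟨Q, hQ, δ, q₀, acc, hacc⟩ := h
  exact ⟨Q, hQ, δ, q₀, acc, fun s V hV => (e s V hV).trans (hacc s V hV)⟩

/-- To check that an automaton recognizes a relation, it is enough to describe its state after
reading the tracks. -/
theorem of_state {Q : Type} [Finite Q] (δ : Letter F → Q → Q) (q₀ : Q) (acc : Q → Prop)
    (inv : ℕ → (Option (Bool × Fin F) → ℕ) → Q → Prop)
    (h0 : ∀ V, (∀ t, V t = 0) → inv 0 V q₀)
    (hs : ∀ s V q, inv s (fun t => V t / 2) q → inv (s + 1) V (δ (fun t => (V t).bodd) q))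
    (hacc : ∀ s V q, (∀ t, V t < 2 ^ s) → inv s V q → (R s V ↔ acc q)) : Automatic R := by
  refine ⟨Q, inferInstance, δ, q₀, acc, fun s V hV => hacc s V _ hV ?_⟩
  induction s generalizing V with
  | zero => exact h0 V fun t => by simpa using hV t
  | succ s ih =>
    refine hs s V _ (ih _ fun t => ?_)
    have := hV t
    rw [pow_succ] at this
    omega

theorem bodd_toNat (m : ℕ) : m.bodd.toNat + 2 * (m / 2) = m := by
  have := Nat.bodd_add_div2 m
  rwa [Nat.div2_val] at this

theorem lt (t t' : Option (Bool × Fin F)) : Automatic fun _ V => V t < V t' := by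
  refine of_state (Q := Bool × Bool)
    (fun l q => (q.1 || (!q.2 && (!l t && l t')), q.2 || (!q.1 && (l t && !l t'))))
    (false, false) (fun q => q.1 = true)
    (fun _ V q => (q.1 = true ↔ V t < V t') ∧ (q.2 = true ↔ V t' < V t)) ?_ ?_ ?_
  · intro V h; simp [h]
  · rintro s V ⟨q, q'⟩ ⟨h, h'⟩
    have h1 := bodd_toNat (V t)
    have h2 := bodd_toNat (V t')
    dsimp only at h h' ⊢
    generalize (V t).bodd = x at h1 ⊢
    generalize (V t').bodd = y at h2 ⊢
    cases x <;> cases y <;> cases q <;> cases q' <;>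
      simp at h1 h2 h h' ⊢ <;> omega
  · intro s V q _ h; exact h.1.symm

theorem eq (t t' : Option (Bool × Fin F)) : Automatic fun _ V => V t = V t' :=
  ((lt t t').not.and (lt t' t).not).congr fun s V _ => by omega

theorem pos (t : Option (Bool × Fin F)) : Automatic fun _ V => 0 < V t := by
  refine of_state (Q := Bool) (fun l q => q || l t) false (fun q => q = true)
    (fun _ V q => q = true ↔ 0 < V t) ?_ ?_ ?_
  · intro V h; simp [h]
  · intro s V q h
    have h1 := bodd_toNat (V t)
    dsimp only at h ⊢
    generalize (V t).bodd = x at h1 ⊢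
    cases x <;> cases q <;> simp at h1 h ⊢ <;> omega
  · intro s V q _ h; exact h.symm

/-- The track `t` has its most significant bit set, and no other. -/
theorem eq_top (t : Option (Bool × Fin F)) : Automatic fun s V => 0 < s ∧ V t = 2 ^ (s - 1) := by
  -- the state `none` means that nothing has been read yet
  refine of_state (Q := Option Bool)
    (fun l q => match q with
      | none => some (l t)
      | some b => some (b && !l t)) none (fun q => q = some true)
    (fun s V q => V t < 2 ^ s ∧ match q with
      | none => s = 0
      | some b => 0 < s ∧ (b = true ↔ V t = 2 ^ (s - 1))) ?_ ?_ ?_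
  · intro V h; exact ⟨by simp [h], rfl⟩
  · rintro s V q ⟨hb, h⟩
    have h1 := bodd_toNat (V t)
    dsimp only at hb h ⊢
    generalize (V t).bodd = x at h1 ⊢
    refine ⟨by rw [pow_succ]; cases x <;> simp at h1 <;> omega, ?_⟩
    match q, h with
    | none, h =>
      dsimp only at h
      subst h
      cases x <;> simp at h1 hb ⊢ <;> omega
    | some b, ⟨h0, h⟩ =>
      obtain ⟨s, rfl⟩ := Nat.exists_eq_succ_of_ne_zero h0.ne'
      simp only [Nat.succ_eq_add_one, Nat.add_sub_cancel, pow_succ] at h ⊢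
      cases x <;> cases b <;> simp at h1 h ⊢ <;> omega
  · rintro s V q hV ⟨-, h⟩
    match q, h with
    | none, h => dsimp only at h; simp [h]
    | some b, h => cases b <;> simp_all

theorem double (t t' : Option (Bool × Fin F)) : Automatic fun _ V => V t = 2 * V t' := by
  -- the state `some k` means that `V t = 2 * V t' + k`
  refine of_state (Q := Option Bool)
    (fun l q => match q with
      | none => none
      | some k => if k = l t' then some (l t) else none) (some false) (fun q => q = some false)
    (fun _ V q => match q with
      | none => V t ≠ 2 * V t' ∧ V t ≠ 2 * V t' + 1
      | some k => V t = 2 * V t' + k.toNat) ?_ ?_ ?_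
  · intro V h; simp [h]
  · intro s V q h
    have h1 := bodd_toNat (V t)
    have h2 := bodd_toNat (V t')
    dsimp only at h ⊢
    match q, h with
    | none, h =>
      dsimp only at h ⊢
      generalize (V t).bodd = x at h1 ⊢
      generalize (V t').bodd = y at h2 ⊢
      have := x.toNat_le
      have := y.toNat_le
      omega
    | some k, h =>
      dsimp only at h ⊢
      rcases Bool.eq_false_or_eq_true (V t).bodd with hx | hx <;>
        rcases Bool.eq_false_or_eq_true (V t').bodd with hy | hy <;>
        cases k <;> simp [hx, hy] at h1 h2 h ⊢ <;> omega
  · intro s V q _ h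
    match q, h with
    | none, h => simp [h.1]
    | some k, h => cases k <;> simp at h ⊢ <;> omega

end Automatic

/-! ### Circuits whose wiring is automatic -/

section Addresses

variable {F : ℕ}

/-- All the fields of `e` have at most `s` bits. -/
def Bdd (s : ℕ) (e : Fin F → ℕ) : Prop := ∀ i, e i < 2 ^ s

/-- The concatenation of fields of `s` bits. -/
def pack (s : ℕ) (e : Fin F → ℕ) : ℕ := ∑ i, e i * (2 ^ s) ^ (i : ℕ)

/-- The first `F` fields of `s` bits of a number. -/
def unpack (F s a : ℕ) (i : Fin F) : ℕ := a / 2 ^ (s * i) % 2 ^ s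

theorem bdd_unpack (s a : ℕ) : Bdd s (unpack F s a) := fun _ => Nat.mod_lt _ (by positivity)

theorem pack_lt {s : ℕ} {e : Fin F → ℕ} (h : Bdd s e) : pack s e < 2 ^ (s * F) := by
  rw [pow_mul]
  exact (finFunctionFinEquiv fun i => (⟨e i, h i⟩ : Fin (2 ^ s))).2

theorem unpack_pack {s : ℕ} {e : Fin F → ℕ} (h : Bdd s e) : unpack F s (pack s e) = e := by
  funext i
  have := congrFun (finFunctionFinEquiv.symm_apply_apply
    fun i => (⟨e i, h i⟩ : Fin (2 ^ s))) i
  have := congrArg Fin.val this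
  rw [unpack, pow_mul]
  exact this

theorem pack_unpack {s a : ℕ} (h : a < 2 ^ (s * F)) : pack s (unpack F s a) = a := by
  rw [pow_mul] at h
  have := congrArg Fin.val (finFunctionFinEquiv.apply_symm_apply (⟨a, h⟩ : Fin ((2 ^ s) ^ F)))
  simp only [pack, unpack, pow_mul]
  exact this

theorem unpack_add (s a j : ℕ) : unpack F s (a + 2 ^ (s * F) * j) = unpack F s a := by
  funext i
  have hi : s * F = s * i + (s + s * (F - 1 - i)) := by
    have : F = i + (1 + (F - 1 - i)) := by omega
    calc s * F = s * (i + (1 + (F - 1 - i))) := by rw [← this]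
      _ = _ := by ring
  rw [unpack, unpack, hi, pow_add, pow_add, mul_assoc, mul_assoc,
    Nat.add_mul_div_left _ _ (by positivity), Nat.add_mul_mod_self_left]

theorem div_add {s a : ℕ} (h : a < 2 ^ (s * F)) (j : ℕ) :
    (a + 2 ^ (s * F) * j) / 2 ^ (s * F) = j := by
  rw [Nat.add_mul_div_left _ _ (by positivity), Nat.div_eq_of_lt h, zero_add]

theorem pack_unpack_add (s a : ℕ) :
    pack s (unpack F s a) + 2 ^ (s * F) * (a / 2 ^ (s * F)) = a := by
  have h : unpack F s a = unpack F s (a % 2 ^ (s * F)) := by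
    conv_lhs => rw [← Nat.mod_add_div a (2 ^ (s * F))]
    rw [unpack_add]
  rw [h, pack_unpack (Nat.mod_lt _ (by positivity)), Nat.mod_add_div]

/-- Only the `s` low-order bits of the tracks are read. -/
theorem word_congr (s : ℕ) (V V' : Option (Bool × Fin F) → ℕ)
    (h : ∀ t, V t % 2 ^ s = V' t % 2 ^ s) : word s V = word s V' := by
  induction s generalizing V V' with
  | zero => rfl
  | succ s ih =>
    rw [word, word]
    congr 1
    · funext t
      have h1 : V t % 2 = V' t % 2 := by
        have := congrArg (· % 2) (h t)
        simpa [Nat.mod_mod_of_dvd, pow_succ] using this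
      rw [Nat.mod_two_of_bodd, Nat.mod_two_of_bodd] at h1
      generalize (V t).bodd = x at *
      generalize (V' t).bodd = y at *
      cases x <;> cases y <;> simp_all
    · refine ih _ _ fun t => ?_
      have := congrArg (· / 2) (h t)
      simpa only [pow_succ', Nat.mod_mul_right_div_self] using this

/-- Tracks carrying `n` and two lists of fields. -/
def join (n : ℕ) (e e' : Fin F → ℕ) : Option (Bool × Fin F) → ℕ
  | none => n
  | some (false, i) => e i
  | some (true, i) => e' i

theorem word_tracks (n a b : ℕ) :
    word (Nat.size n) (Scanner.tracks F n a b) =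
      word (Nat.size n) (join n (unpack F (Nat.size n) a) (unpack F (Nat.size n) b)) := by
  refine word_congr _ _ _ fun t => ?_
  match t with
  | none => rfl
  | some (false, i) => simp [Scanner.tracks, join, unpack]
  | some (true, i) => simp [Scanner.tracks, join, unpack]

theorem join_lt {n : ℕ} {e e' : Fin F → ℕ} (h : Bdd (Nat.size n) e) (h' : Bdd (Nat.size n) e') :
    ∀ t, join n e e' t < 2 ^ Nat.size n
  | none => Nat.lt_size_self n
  | some (false, i) => h i
  | some (true, i) => h' i

end Addresses

/-- A description of a family of circuits. The gates of the `n`-th circuit are the pairs of a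
`Tag` and of `F` fields of `s = Nat.size n` bits; `rel τ τ' s n e e'` says that the gate `(τ', e')`
feeds into the gate `(τ, e)`. A gate `(τ, e)` of kind `input` reads the input bit
`4 * pack s e + low τ`, as `interleave` merges the inputs with period four. The gates with the tag
`root` produce the output. -/
structure GateSpec (F : ℕ) where
  Tag : Type
  finTag : Finite Tag
  root : Tag
  kind : Tag → GateKind
  low : Tag → Fin 4
  rel : Tag → Tag → ℕ → ℕ → (Fin F → ℕ) → (Fin F → ℕ) → Prop
  automatic : ∀ τ τ', Automatic fun s V =>
    rel τ τ' s (V none) (fun i => V (some (false, i))) (fun i => V (some (true, i)))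
  level : Tag → (Fin F → ℕ) → ℕ
  level_lt : ∀ τ τ' s n e e', kind τ ≠ .input → Bdd s e → Bdd s e' → rel τ τ' s n e e' →
    level τ' e' < level τ e
  not_unary : ∀ τ s n e, kind τ = .not → Bdd s e →
    ∃! p : Tag × (Fin F → ℕ), Bdd s p.2 ∧ rel τ p.1 s n e p.2

namespace GateSpec

variable {F : ℕ} (S : GateSpec F)

/-- The value `v τ e` of the gate `(τ, e)` is computed from those of the gates that feed into it. -/
def GateEq (n : ℕ) (x : ℕ → Prop) (v : S.Tag → (Fin F → ℕ) → Prop) (τ : S.Tag) (e : Fin F → ℕ) :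
    Prop :=
  match S.kind τ with
  | .input => v τ e ↔ x (4 * pack (Nat.size n) e + S.low τ)
  | .not => v τ e ↔ ∃ τ' e', Bdd (Nat.size n) e' ∧ S.rel τ τ' (Nat.size n) n e e' ∧ ¬ v τ' e'
  | .and => v τ e ↔ ∀ τ' e', Bdd (Nat.size n) e' → S.rel τ τ' (Nat.size n) n e e' → v τ' e'
  | .or => v τ e ↔ ∃ τ' e', Bdd (Nat.size n) e' ∧ S.rel τ τ' (Nat.size n) n e e' ∧ v τ' e'

/-- A number is determined by its two low-order bits and the rest. -/
theorem eq_of_bodd {b : ℕ} {l : Fin 4} (h1 : b.bodd = (l : ℕ).bodd)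
    (h2 : (b / 2).bodd = ((l : ℕ) / 2).bodd) : b = 4 * (b / 2 / 2) + l := by
  have a1 := Automatic.bodd_toNat b
  have a2 := Automatic.bodd_toNat (b / 2)
  have a3 := Automatic.bodd_toNat l
  have a4 := Automatic.bodd_toNat ((l : ℕ) / 2)
  rw [h1] at a1
  rw [h2] at a2
  have := l.2
  omega

theorem div_of_eq {p : ℕ} {l : Fin 4} : (4 * p + (l : ℕ)).bodd = (l : ℕ).bodd ∧
    ((4 * p + (l : ℕ)) / 2).bodd = ((l : ℕ) / 2).bodd ∧ (4 * p + (l : ℕ)) / 2 / 2 = p := by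
  have h : (4 * p + (l : ℕ)) / 2 = 2 * p + (l : ℕ) / 2 := by omega
  refine ⟨by simp [show 4 * p = 2 * (2 * p) by ring], by rw [h]; simp, by omega⟩

open Classical in
/-- The wiring of the circuits described by `S` is recognized by a scanner. -/
theorem exists_scanner : ∃ (T : ℕ) (num : S.Tag ≃ Fin T) (P : Scanner F T),
    (num S.root : ℕ) = 0 ∧
    (∀ n a b b', (P.result (n, a, b)).1 = (P.result (n, a, b')).1) ∧
    (∀ n a b, T ≤ a / 2 ^ (Nat.size n * F) → P.result (n, a, b) = (.or, false)) ∧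
    ∀ n τ e, Bdd (Nat.size n) e → ∀ b,
      (P.result (n, pack (Nat.size n) e + 2 ^ (Nat.size n * F) * num τ, b)).1 = S.kind τ ∧
      ((P.result (n, pack (Nat.size n) e + 2 ^ (Nat.size n * F) * num τ, b)).2 = true ↔
        if S.kind τ = .input then b = 4 * pack (Nat.size n) e + S.low τ
        else ∃ τ' e', Bdd (Nat.size n) e' ∧ S.rel τ τ' (Nat.size n) n e e' ∧
          b = pack (Nat.size n) e' + 2 ^ (Nat.size n * F) * num τ') := by
  have := S.finTag
  obtain ⟨T, ⟨num₀⟩⟩ := Finite.exists_equiv_fin S.Tag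
  have hT : 0 < T := (num₀ S.root).pos
  set num : S.Tag ≃ Fin T := num₀.trans (Equiv.swap (num₀ S.root) ⟨0, hT⟩) with hnum
  obtain ⟨Q, hQ, δ, q₀, acc, hacc⟩ := Automatic.simultaneously (F := F)
    (ι := Option (S.Tag × S.Tag))
    (R := fun p s V => match p with
      | none => ∀ i, V (some (false, i)) = V (some (true, i))
      | some (τ, τ') =>
        S.rel τ τ' s (V none) (fun i => V (some (false, i))) (fun i => V (some (true, i))))
    (fun p => match p with
      | none => Automatic.forall_finite fun i => Automatic.eq _ _
      | some (τ, τ') => S.automatic τ τ')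
  let P : Scanner F T :=
    { Q := Q
      finQ := hQ
      δ := δ
      q₀ := q₀
      isIn := fun t => decide (∃ h : t.1 < T, S.kind (num.symm ⟨t.1, h⟩) = .input)
      out := fun tA tB low q =>
        if h : tA.1 < T then
          (S.kind (num.symm ⟨tA.1, h⟩), decide (
            if S.kind (num.symm ⟨tA.1, h⟩) = .input then
              tB.1 = 0 ∧ low = ((S.low (num.symm ⟨tA.1, h⟩) : ℕ).bodd,
                ((S.low (num.symm ⟨tA.1, h⟩) : ℕ) / 2).bodd) ∧ acc none q
            else ∃ h' : tB.1 < T, acc (some (num.symm ⟨tA.1, h⟩, num.symm ⟨tB.1, h'⟩)) q))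
        else (.or, false) }
  refine ⟨T, num, P, by simp [hnum], ?_, ?_, ?_⟩
  · intro n a b b'
    simp only [Scanner.result, P]
    split_ifs <;> rfl
  · intro n a b h
    have : ¬ (sat T (a / 2 ^ (Nat.size n * F))).1 < T := by simp only [sat]; omega
    simp only [Scanner.result, P]
    rw [dif_neg this]
  · intro n τ e he b
    have htag := div_add (pack_lt he) (num τ)
    have hsat : sat T (num τ : ℕ) = (num τ).castSucc := by
      ext; simp only [sat, Fin.val_castSucc]; omega
    have hlt : ((num τ).castSucc).1 < T := (num τ).2
    have hsymm : num.symm ⟨((num τ).castSucc).1, hlt⟩ = τ := num.symm_apply_apply τ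
    have hun : unpack F (Nat.size n) (pack (Nat.size n) e + 2 ^ (Nat.size n * F) * num τ) = e := by
      rw [unpack_add, unpack_pack he]
    have hin : P.isIn (num τ).castSucc = decide (S.kind τ = .input) := by
      simp only [P, hsymm, hlt, exists_true_left]
    have hword : ∀ b', word (Nat.size n) (Scanner.tracks F n
        (pack (Nat.size n) e + 2 ^ (Nat.size n * F) * num τ) b') =
        word (Nat.size n) (join n e (unpack F (Nat.size n) b')) := by
      intro b'; rw [word_tracks, hun]
    simp only [Scanner.result, htag, hsat, hword, hin]
    refine ⟨by simp only [P, dif_pos hlt, hsymm], ?_⟩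
    by_cases hk : S.kind τ = .input
    · simp only [P, dif_pos hlt, hsymm, hk, if_true, decide_true, decide_eq_true_eq]
      rw [← hacc none (Nat.size n) _ (join_lt he (bdd_unpack _ _))]
      simp only [join, Prod.mk.injEq]
      constructor
      · rintro ⟨h0, ⟨h1, h2⟩, h3⟩
        have h0 : b / 2 / 2 / 2 ^ (Nat.size n * F) = 0 := by
          simp only [sat] at h0; omega
        have h4 := pack_unpack_add (F := F) (Nat.size n) (b / 2 / 2)
        rw [h0, mul_zero, add_zero, ← funext h3] at h4
        rw [h4]
        exact eq_of_bodd h1 h2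
      · rintro rfl
        obtain ⟨h1, h2, h3⟩ := div_of_eq (p := pack (Nat.size n) e) (l := S.low τ)
        refine ⟨?_, ⟨h1, h2⟩, ?_⟩
        · rw [h3, Nat.div_eq_of_lt (pack_lt he)]; simp [sat]
        · intro i; rw [h3, unpack_pack he]
    · simp only [P, dif_pos hlt, hsymm, hk, if_false, decide_false, Bool.false_eq_true,
        decide_eq_true_eq]
      constructor
      · rintro ⟨h', h⟩
        rw [← hacc (some _) (Nat.size n) _ (join_lt he (bdd_unpack _ _))] at h
        refine ⟨_, _, bdd_unpack _ _, h, ?_⟩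
        have : b / 2 ^ (Nat.size n * F) = (sat T (b / 2 ^ (Nat.size n * F))).1 := by
          simp only [sat] at h' ⊢; omega
        rw [Equiv.apply_symm_apply]
        conv_lhs => rw [← pack_unpack_add (F := F) (Nat.size n) b, this]
      · rintro ⟨τ', e', he', h, rfl⟩
        have htag' := div_add (pack_lt he') (num τ')
        have hsat' : sat T (num τ' : ℕ) = (num τ').castSucc := by
          ext; simp only [sat, Fin.val_castSucc]; omega
        simp only [htag', hsat', unpack_add, unpack_pack he']
        have hs' : num.symm ⟨((num τ').castSucc).1, (num τ').2⟩ = τ' := num.symm_apply_apply τ'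
        refine ⟨(num τ').2, ?_⟩
        rw [hs', ← hacc (some _) (Nat.size n) _ (join_lt he he')]
        exact h

theorem two_pow_size_le {n : ℕ} (hn : n ≠ 0) : 2 ^ Nat.size n ≤ 2 * n := by
  obtain ⟨k, hk⟩ := Nat.exists_eq_succ_of_ne_zero (Nat.size_pos.2 (Nat.pos_of_ne_zero hn)).ne'
  have : 2 ^ k ≤ n := Nat.lt_size.1 (by omega)
  rw [hk, pow_succ]
  omega

/-- The number of gates is at most the prescribed polynomial. -/
theorem size_bound (F T k n : ℕ) (hk : F + T * 2 ^ F ≤ k) :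
    2 ^ (Nat.size n * F) * T ≤ n ^ k + k := by
  rcases Nat.lt_or_ge n 2 with hn | hn
  · have : 2 ^ (Nat.size n * F) ≤ 2 ^ F := by
      refine Nat.pow_le_pow_right (by norm_num) ?_
      interval_cases n <;> simp
    calc 2 ^ (Nat.size n * F) * T ≤ 2 ^ F * T := Nat.mul_le_mul_right _ this
      _ = T * 2 ^ F := mul_comm _ _
      _ ≤ n ^ k + k := by omega
  · have h1 : 2 ^ (Nat.size n * F) ≤ n ^ F * 2 ^ F := by
      rw [pow_mul, ← mul_pow, mul_comm n]
      exact Nat.pow_le_pow_left (two_pow_size_le (by omega)) _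
    have h2 : T * 2 ^ F ≤ n ^ (T * 2 ^ F) := by
      exact (Nat.lt_pow_self (by omega : 1 < n)).le
    calc 2 ^ (Nat.size n * F) * T ≤ n ^ F * 2 ^ F * T := Nat.mul_le_mul_right _ h1
      _ = n ^ F * (T * 2 ^ F) := by ring
      _ ≤ n ^ F * n ^ (T * 2 ^ F) := Nat.mul_le_mul_left _ h2
      _ = n ^ (F + T * 2 ^ F) := (pow_add _ _ _).symm
      _ ≤ n ^ k := Nat.pow_le_pow_right (by omega) hk
      _ ≤ n ^ k + k := Nat.le_add_right _ _

theorem circuit_eval_input {C : Circuit} {x : ℕ → Prop} {a : ℕ} (h : C.kind a = .input) :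
    C.eval x a ↔ ∃ i, C.wire a i = true ∧ x i := by
  rw [Circuit.eval]; split <;> simp_all

theorem circuit_eval_not {C : Circuit} {x : ℕ → Prop} {a : ℕ} (h : C.kind a = .not) :
    C.eval x a ↔ ∃ b, C.Child a b ∧ ¬ C.eval x b := by
  rw [Circuit.eval]; split <;> simp_all

theorem circuit_eval_and {C : Circuit} {x : ℕ → Prop} {a : ℕ} (h : C.kind a = .and) :
    C.eval x a ↔ ∀ b, C.Child a b → C.eval x b := by
  rw [Circuit.eval]; split <;> simp_all

theorem circuit_eval_or {C : Circuit} {x : ℕ → Prop} {a : ℕ} (h : C.kind a = .or) :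
    C.eval x a ↔ ∃ b, C.Child a b ∧ C.eval x b := by
  rw [Circuit.eval]; split <;> simp_all

/-- A family of circuits with automatic wiring is uniform, and the values of its gates satisfy the
expected equations. The output bits with numbers `pack s e` are the values of the root gates. -/
theorem exists_uniformAC (t : ℕ → ℕ) (L : ℕ)
    (hL : ∀ n τ e, Bdd (Nat.size n) e → S.level τ e ≤ L * t n + L) :
    ∃ C : ℕ → Circuit, UniformAC t C ∧ ∀ n x, ∃ v : S.Tag → (Fin F → ℕ) → Prop,
      (∀ τ e, Bdd (Nat.size n) e → S.GateEq n x v τ e) ∧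
      ∀ e, Bdd (Nat.size n) e → ((C n).output x (pack (Nat.size n) e) ↔ v S.root e) := by
  obtain ⟨T, num, P, hroot, hkind, hbig, hres⟩ := S.exists_scanner
  set k := F + T * 2 ^ F + L with hk
  let gate : ℕ → S.Tag → (Fin F → ℕ) → ℕ := fun n τ e =>
    pack (Nat.size n) e + 2 ^ (Nat.size n * F) * num τ
  have gate_eq : ∀ n a, a / 2 ^ (Nat.size n * F) < T →
      ∃ τ e, Bdd (Nat.size n) e ∧ a = gate n τ e := by
    intro n a h
    refine ⟨num.symm ⟨_, h⟩, unpack F (Nat.size n) a, bdd_unpack _ _, ?_⟩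
    simp only [gate, Equiv.apply_symm_apply, pack_unpack_add]
  have gate_tag : ∀ n τ e, Bdd (Nat.size n) e →
      gate n τ e / 2 ^ (Nat.size n * F) = num τ := fun n τ e he => div_add (pack_lt he) _
  have gate_unpack : ∀ n τ e, Bdd (Nat.size n) e → unpack F (Nat.size n) (gate n τ e) = e :=
    fun n τ e he => by simp only [gate, unpack_add, unpack_pack he]
  have gate_lt : ∀ n τ e, Bdd (Nat.size n) e → gate n τ e < n ^ k + k := by
    intro n τ e he
    refine lt_of_lt_of_le ?_ (size_bound F T k n (by omega))
    refine (Nat.div_lt_iff_lt_mul (by positivity)).1 ?_ |>.trans_eq (mul_comm _ _)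
    rw [gate_tag n τ e he]
    exact (num τ).2
  have gate_kind : ∀ n τ e, Bdd (Nat.size n) e → (P.result (n, gate n τ e, 0)).1 = S.kind τ :=
    fun n τ e he => (hres n τ e he 0).1
  have gate_wire : ∀ n τ e, Bdd (Nat.size n) e → S.kind τ ≠ .input → ∀ b,
      ((P.result (n, gate n τ e, b)).2 = true ↔
        ∃ τ' e', Bdd (Nat.size n) e' ∧ S.rel τ τ' (Nat.size n) n e e' ∧ b = gate n τ' e') := by
    intro n τ e he hτ b
    have := (hres n τ e he b).2
    rwa [if_neg hτ] at this
  have small : ∀ n a b, (P.result (n, a, b)).1 ≠ .or ∨ (P.result (n, a, b)).2 = true →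
      a / 2 ^ (Nat.size n * F) < T := by
    intro n a b h
    by_contra hc
    rw [hbig n a b (by omega)] at h
    simp at h
  let level : ℕ → ℕ → ℕ := fun n a =>
    if h : a / 2 ^ (Nat.size n * F) < T then S.level (num.symm ⟨_, h⟩) (unpack F (Nat.size n) a)
    else 0
  have gate_level : ∀ n τ e, Bdd (Nat.size n) e → level n (gate n τ e) = S.level τ e := by
    intro n τ e he
    have h := gate_tag n τ e he
    simp only [level, h, gate_unpack n τ e he, Fin.is_lt, dif_pos, Fin.eta, Equiv.symm_apply_apply]
  let C : ℕ → Circuit := fun n =>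
    { size := n ^ k + k
      kind := fun a => (P.result (n, a, 0)).1
      wire := fun a b => (P.result (n, a, b)).2
      level := level n
      level_lt := by
        intro a b _ _ ha hab
        obtain ⟨τ, e, he, rfl⟩ := gate_eq n a (small n a b (Or.inr hab))
        rw [gate_kind n τ e he] at ha
        obtain ⟨τ', e', he', hr, rfl⟩ := (gate_wire n τ e he ha b).1 hab
        rw [gate_level n τ e he, gate_level n τ' e' he']
        exact S.level_lt τ τ' _ n e e' ha he he' hr
      input_unary := by
        intro a _ ha
        obtain ⟨τ, e, he, rfl⟩ := gate_eq n a (small n a 0 (Or.inl (by rw [ha]; simp)))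
        rw [gate_kind n τ e he] at ha
        refine ⟨_, ((hres n τ e he _).2).2 (by rw [if_pos ha]), fun b hb => ?_⟩
        have := ((hres n τ e he b).2).1 hb
        rwa [if_pos ha] at this
      not_unary := by
        intro a _ ha
        obtain ⟨τ, e, he, rfl⟩ := gate_eq n a (small n a 0 (Or.inl (by rw [ha]; simp)))
        rw [gate_kind n τ e he] at ha
        obtain ⟨⟨τ', e'⟩, ⟨he', hr⟩, huniq⟩ := S.not_unary τ (Nat.size n) n e ha he
        refine ⟨gate n τ' e', ⟨gate_lt n τ' e' he',
          (gate_wire n τ e he (by rw [ha]; simp) _).2 ⟨τ', e', he', hr, rfl⟩⟩, ?_⟩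
        rintro b ⟨-, hb⟩
        obtain ⟨τ₁, e₁, he₁, hr₁, rfl⟩ := (gate_wire n τ e he (by rw [ha]; simp) b).1 hb
        have := huniq ⟨τ₁, e₁⟩ ⟨he₁, hr₁⟩
        simp only [Prod.mk.injEq] at this
        rw [this.1, this.2] }
  refine ⟨C, ⟨?_, k, fun n => ⟨rfl, fun a _ => ?_⟩⟩, fun n x => ?_⟩
  · have : (fun q : ℕ × ℕ × ℕ => ((C q.1).kind q.2.1, (C q.1).wire q.2.1 q.2.2)) = P.result := by
      funext q
      exact Prod.ext (hkind q.1 q.2.1 0 q.2.2) rfl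
    unfold DLogTimeUniform
    rw [this]
    exact P.exists_computableInTime
  · have hLk : L * t n + L ≤ k * t n + k :=
      Nat.add_le_add (Nat.mul_le_mul_right _ (by omega)) (by omega)
    change level n a ≤ _
    by_cases h : a / 2 ^ (Nat.size n * F) < T
    · simp only [level, dif_pos h]
      exact (hL n _ _ (bdd_unpack _ _)).trans hLk
    · simp only [level, dif_neg h]; omega
  · refine ⟨fun τ e => (C n).eval x (gate n τ e), fun τ e he => ?_, fun e he => ?_⟩
    · have hk : (C n).kind (gate n τ e) = S.kind τ := gate_kind n τ e he
      have hchild : S.kind τ ≠ .input → ∀ b, (C n).Child (gate n τ e) b ↔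
          ∃ τ' e', Bdd (Nat.size n) e' ∧ S.rel τ τ' (Nat.size n) n e e' ∧ b = gate n τ' e' := by
        intro hτ b
        refine ⟨fun h => (gate_wire n τ e he hτ b).1 h.2.2, fun h => ?_⟩
        refine ⟨gate_lt n τ e he, ?_, (gate_wire n τ e he hτ b).2 h⟩
        obtain ⟨τ', e', he', _, rfl⟩ := h
        exact gate_lt n τ' e' he'
      unfold GateEq
      split
      next h =>
        beta_reduce
        rw [circuit_eval_input (hk.trans h)]
        have hw : ∀ i, (C n).wire (gate n τ e) i = true ↔
            i = 4 * pack (Nat.size n) e + S.low τ := by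
          intro i
          have := (hres n τ e he i).2
          rwa [if_pos h] at this
        simp only [hw, exists_eq_left]
      next h =>
        beta_reduce
        rw [circuit_eval_not (hk.trans h)]
        simp only [hchild (by rw [h]; simp)]
        constructor
        · rintro ⟨b, ⟨τ', e', he', hr, rfl⟩, hb⟩; exact ⟨τ', e', he', hr, hb⟩
        · rintro ⟨τ', e', he', hr, hb⟩; exact ⟨_, ⟨τ', e', he', hr, rfl⟩, hb⟩
      next h =>
        beta_reduce
        rw [circuit_eval_and (hk.trans h)]
        simp only [hchild (by rw [h]; simp)]
        constructor
        · intro H τ' e' he' hr; exact H _ ⟨τ', e', he', hr, rfl⟩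
        · rintro H b ⟨τ', e', he', hr, rfl⟩; exact H τ' e' he' hr
      next h =>
        beta_reduce
        rw [circuit_eval_or (hk.trans h)]
        simp only [hchild (by rw [h]; simp)]
        constructor
        · rintro ⟨b, ⟨τ', e', he', hr, rfl⟩, hb⟩; exact ⟨τ', e', he', hr, hb⟩
        · rintro ⟨τ', e', he', hr, hb⟩; exact ⟨_, ⟨τ', e', he', hr, rfl⟩, hb⟩
    · have h : gate n S.root e = pack (Nat.size n) e := by
        simp only [gate, hroot, mul_zero, add_zero]
      beta_reduce
      rw [h]
      refine ⟨fun h => h.2, fun h' => ⟨?_, h'⟩⟩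
      have := gate_lt n S.root e he
      rwa [h] at this

end GateSpec

/-! ### First-order formulas and their circuits -/

/-- The sources of an explicit substitution: a register, zero, or the power of two with the most
significant bit set. -/
inductive Src (F : ℕ)
  | reg (i : Fin F)
  | zero
  | top

/-- The value of a source. -/
def Src.val {F : ℕ} (s : ℕ) (e : Fin F → ℕ) : Src F → ℕ
  | .reg i => e i
  | .zero => 0
  | .top => 2 ^ (s - 1)

/-- First-order formulas over `F` registers holding numbers, with relation symbols `R`. The formula
`inp r` reads the input bit whose number is given by all the registers together, `sub σ φ` evaluates
`φ` after the substitution `σ`, and `prev c k` evaluates the relation `k` after halving the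
register `c`, which has to be even and positive. -/
inductive Form (F : ℕ) (R : Type)
  | tru
  | inp (r : Fin 4)
  | lt (i j : Fin F)
  | neg (φ : Form F R)
  | conj (φ ψ : Form F R)
  | ex (i : Fin F) (φ : Form F R)
  | sub (σ : Fin F → Src F) (φ : Form F R)
  | prev (c : Fin F) (k : R)
  | rel (k : R)

namespace Form

variable {F : ℕ} {R : Type}

/-- The truth value of a formula when the registers contain `e`. Registers have `s` bits,
quantifiers range over the numbers below `n`, the input is `x` and the relation symbols are
interpreted by `v`. -/
def sem (s n : ℕ) (x : ℕ → Prop) (v : R → (Fin F → ℕ) → Prop) : Form F R → (Fin F → ℕ) → Prop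
  | tru, _ => True
  | inp r, e => x (4 * pack s e + r)
  | lt i j, e => e i < e j
  | neg φ, e => ¬ φ.sem s n x v e
  | conj φ ψ, e => φ.sem s n x v e ∧ ψ.sem s n x v e
  | ex i φ, e => ∃ a : Fin n, φ.sem s n x v (Function.update e i a)
  | sub σ φ, e => φ.sem s n x v (fun j => (σ j).val s e)
  | prev c k, e => ∃ a, 0 < a ∧ e c = 2 * a ∧ v k (Function.update e c a)
  | rel k, e => v k e

/-- The set of subformulas. -/
def subs : Form F R → Set (Form F R)
  | neg φ => insert (neg φ) φ.subs
  | conj φ ψ => insert (conj φ ψ) (φ.subs ∪ ψ.subs)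
  | ex i φ => insert (ex i φ) φ.subs
  | sub σ φ => insert (sub σ φ) φ.subs
  | φ => {φ}

theorem finite_subs (φ : Form F R) : φ.subs.Finite := by
  induction φ with
  | neg φ ih => exact ih.insert _
  | conj φ ψ ih ih' => exact (ih.union ih').insert _
  | ex i φ ih => exact ih.insert _
  | sub σ φ ih => exact ih.insert _
  | _ => exact Set.finite_singleton _

theorem self_mem_subs (φ : Form F R) : φ ∈ φ.subs := by
  cases φ <;> simp [subs]

/-- The immediate subformulas, as far as they are not relation symbols. -/
def IsPart : Form F R → Form F R → Prop
  | neg φ, χ => χ = φ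
  | conj φ ψ, χ => χ = φ ∨ χ = ψ
  | ex _ φ, χ => χ = φ
  | sub _ φ, χ => χ = φ
  | _, _ => False

theorem IsPart.mem_subs {φ ψ χ : Form F R} (h : ψ.IsPart χ) (hψ : ψ ∈ φ.subs) : χ ∈ φ.subs := by
  induction φ with
  | neg φ ih =>
    rcases hψ with rfl | hψ
    · obtain rfl : χ = φ := h
      exact Or.inr χ.self_mem_subs
    · exact Or.inr (ih hψ)
  | conj φ φ' ih ih' =>
    rcases hψ with rfl | hψ | hψ
    · rcases h with h | h
      · subst h; exact Or.inr (Or.inl χ.self_mem_subs)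
      · subst h; exact Or.inr (Or.inr χ.self_mem_subs)
    · exact Or.inr (Or.inl (ih hψ))
    · exact Or.inr (Or.inr (ih' hψ))
  | ex i φ ih =>
    rcases hψ with rfl | hψ
    · obtain rfl : χ = φ := h
      exact Or.inr χ.self_mem_subs
    · exact Or.inr (ih hψ)
  | sub σ φ ih =>
    rcases hψ with rfl | hψ
    · obtain rfl : χ = φ := h
      exact Or.inr χ.self_mem_subs
    · exact Or.inr (ih hψ)
  | _ => obtain rfl := Set.mem_singleton_iff.1 hψ; exact absurd h id

/-- The registers in `clk` are clocks: they are not quantified, substitutions preserve or erase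
them, and only they may be halved. -/
def WF (clk : Finset (Fin F)) : Form F R → Prop
  | neg φ => φ.WF clk
  | conj φ ψ => φ.WF clk ∧ ψ.WF clk
  | ex i φ => i ∉ clk ∧ φ.WF clk
  | sub σ φ => (∀ c ∈ clk, σ c = .reg c ∨ σ c = .zero) ∧ φ.WF clk
  | prev c _ => c ∈ clk
  | _ => True

theorem WF.mem_subs {clk : Finset (Fin F)} {φ ψ : Form F R} (h : φ.WF clk) (hψ : ψ ∈ φ.subs) :
    ψ.WF clk := by
  induction φ with
  | neg φ ih =>
    rcases hψ with rfl | hψ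
    exacts [h, ih h hψ]
  | conj φ φ' ih ih' =>
    rcases hψ with rfl | hψ | hψ
    exacts [h, ih h.1 hψ, ih' h.2 hψ]
  | ex i φ ih =>
    rcases hψ with rfl | hψ
    exacts [h, ih h.2 hψ]
  | sub σ φ ih =>
    rcases hψ with rfl | hψ
    exacts [h, ih h.2 hψ]
  | _ => obtain rfl := Set.mem_singleton_iff.1 hψ; exact h

/-- The depth of the circuit for a formula, where the relation symbol `k` has depth `rank k`. -/
def lev (rank : R → ℕ) : Form F R → ℕ
  | tru => 0
  | inp _ => 0
  | lt _ _ => 1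
  | neg φ => φ.lev rank + 1
  | conj φ ψ => max (φ.lev rank) (ψ.lev rank) + 1
  | ex _ φ => φ.lev rank + 1
  | sub _ φ => φ.lev rank + 1
  | prev _ _ => 0
  | rel k => rank k

/-- The kind of the gates for a formula. -/
def kind : Form F R → GateKind
  | tru => .and
  | inp _ => .input
  | neg _ => .not
  | conj _ _ => .and
  | _ => .or

/-- The input stream that a formula reads. -/
def low : Form F R → Fin 4
  | inp r => r
  | _ => 0

/-- The gates `(χ, e')` that feed into the gate `(φ, e)`. -/
def Feeds (body : R → Form F R) (s n : ℕ) (e e' : Fin F → ℕ) : Form F R → Form F R → Prop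
  | tru, _ => False
  | inp _, _ => False
  | lt i j, χ => χ = tru ∧ e i < e j ∧ ∀ l, e' l = e l
  | neg φ, χ => χ = φ ∧ ∀ l, e' l = e l
  | conj φ ψ, χ => (χ = φ ∨ χ = ψ) ∧ ∀ l, e' l = e l
  | ex i φ, χ => χ = φ ∧ e' i < n ∧ ∀ l, l ≠ i → e' l = e l
  | sub σ φ, χ => χ = φ ∧ ∀ l, match σ l with
      | .reg i => e' l = e i
      | .zero => ¬ 0 < e' l
      | .top => 0 < s ∧ e' l = 2 ^ (s - 1)
  | prev c k, χ => χ = rel k ∧ 0 < e' c ∧ e c = 2 * e' c ∧ ∀ l, l ≠ c → e' l = e l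
  | rel k, χ => χ = body k ∧ ∀ l, e' l = e l

theorem automatic_ne {P : Prop} {Q : ℕ → (Option (Bool × Fin F) → ℕ) → Prop} (h : Automatic Q) :
    Automatic fun s V => P → Q s V := by
  by_cases hP : P
  · simpa [hP] using h
  · simpa [hP] using Automatic.const True

theorem automatic_feeds (body : R → Form F R) (φ χ : Form F R) :
    Automatic fun s V => Feeds body s (V none) (fun i => V (some (false, i)))
      (fun i => V (some (true, i))) φ χ := by
  have hid : Automatic fun _ V => ∀ l : Fin F, V (some (true, l)) = V (some (false, l)) :=
    Automatic.forall_finite fun l => Automatic.eq _ _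
  have hne : ∀ i, Automatic fun _ V => ∀ l : Fin F, l ≠ i →
      V (some (true, l)) = V (some (false, l)) :=
    fun i => Automatic.forall_finite fun l => automatic_ne (Automatic.eq _ _)
  cases φ with
  | tru => exact Automatic.const False
  | inp r => exact Automatic.const False
  | lt i j => exact (Automatic.const _).and ((Automatic.lt _ _).and hid)
  | neg φ => exact (Automatic.const _).and hid
  | conj φ ψ => exact (Automatic.const _).and hid
  | ex i φ => exact (Automatic.const _).and ((Automatic.lt _ _).and (hne i))
  | sub σ φ =>
    refine (Automatic.const _).and (Automatic.forall_finite fun l => ?_)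
    cases σ l with
    | reg i => exact Automatic.eq _ _
    | zero => exact (Automatic.pos _).not
    | top => exact Automatic.eq_top _
  | prev c k =>
    exact (Automatic.const _).and ((Automatic.pos _).and ((Automatic.double _ _).and (hne c)))
  | rel k => exact (Automatic.const _).and hid

end Form

/-- A system of mutually recursive definitions of the relations in `R` by the formulas `body`; the
relation `out` is the output, and `clk` is the set of the clocks. The ranks witness that the
recursion is well-founded between two ticks of a clock, that is, between two halvings by `prev`. -/
structure Program (F : ℕ) where
  R : Type
  fintypeR : Fintype R
  body : R → Form F R
  out : R
  clk : Finset (Fin F)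
  rank : R → ℕ
  wf : ∀ k, (body k).WF clk
  lev_lt : ∀ k, (body k).lev rank < rank k

namespace Program

open Form

attribute [instance] fintypeR

variable {F : ℕ} (P : Program F)

/-- The formulas for which there are gates. -/
def gates : Set (Form F P.R) := {tru} ∪ Set.range rel ∪ ⋃ k, (P.body k).subs

theorem finite_gates : P.gates.Finite :=
  ((Set.finite_singleton _).union (Set.finite_range _)).union
    (Set.finite_iUnion fun k => (P.body k).finite_subs)

theorem tru_mem : tru ∈ P.gates := Or.inl (Or.inl rfl)

theorem rel_mem (k : P.R) : rel k ∈ P.gates := Or.inl (Or.inr ⟨k, rfl⟩)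

theorem body_mem (k : P.R) : P.body k ∈ P.gates :=
  Or.inr (Set.mem_iUnion.2 ⟨k, self_mem_subs _⟩)

theorem part_mem {φ χ : Form F P.R} (hφ : φ ∈ P.gates) (h : φ.IsPart χ) : χ ∈ P.gates := by
  rcases hφ with (rfl | ⟨k, rfl⟩) | hφ
  · exact absurd h id
  · exact absurd h id
  · obtain ⟨k, hk⟩ := Set.mem_iUnion.1 hφ
    exact Or.inr (Set.mem_iUnion.2 ⟨k, h.mem_subs hk⟩)

theorem wf_of_mem {φ : Form F P.R} (hφ : φ ∈ P.gates) : φ.WF P.clk := by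
  rcases hφ with (rfl | ⟨k, rfl⟩) | hφ
  · trivial
  · trivial
  · obtain ⟨k, hk⟩ := Set.mem_iUnion.1 hφ
    exact (P.wf k).mem_subs hk

/-- A bound for the ranks, which is the number of levels for one tick of a clock. -/
def tick : ℕ := ∑ k, P.rank k + 1

theorem rank_lt_tick (k : P.R) : P.rank k < P.tick :=
  Nat.lt_succ_of_le (Finset.single_le_sum (f := P.rank) (fun _ _ => Nat.zero_le _)
    (Finset.mem_univ k))

/-- The level of the gate for the formula `φ` and the registers `e`. -/
def level (φ : Form F P.R) (e : Fin F → ℕ) : ℕ :=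
  P.tick * ∑ c ∈ P.clk, Nat.log 2 (e c) + φ.lev P.rank

theorem level_lt {φ χ : Form F P.R} (hφ : φ.WF P.clk) {s n : ℕ} {e e' : Fin F → ℕ}
    (h : Feeds P.body s n e e' φ χ) : P.level χ e' < P.level φ e := by
  have key : (∀ c ∈ P.clk, Nat.log 2 (e' c) ≤ Nat.log 2 (e c)) → χ.lev P.rank < φ.lev P.rank →
      P.level χ e' < P.level φ e := fun h1 h2 =>
    Nat.add_lt_add_of_le_of_lt (Nat.mul_le_mul_left _ (Finset.sum_le_sum h1)) h2
  cases φ with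
  | tru => exact absurd h id
  | inp r => exact absurd h id
  | lt i j =>
    obtain ⟨rfl, -, h⟩ := h
    exact key (fun c _ => by rw [h c]) (by simp [lev])
  | neg φ =>
    obtain ⟨rfl, h⟩ := h
    exact key (fun c _ => by rw [h c]) (by simp [lev])
  | conj φ ψ =>
    obtain ⟨h', h⟩ := h
    refine key (fun c _ => by rw [h c]) ?_
    rcases h' with rfl | rfl <;> simp only [lev] <;> omega
  | ex i φ =>
    obtain ⟨rfl, -, h⟩ := h
    refine key (fun c hc => ?_) (by simp [lev])
    rw [h c]
    rintro rfl
    exact hφ.1 hc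
  | sub σ φ =>
    obtain ⟨rfl, h⟩ := h
    refine key (fun c hc => ?_) (by simp [lev])
    have h := h c
    rcases hφ.1 c hc with h' | h'
    · rw [h'] at h
      rw [show e' c = e c from h]
    · rw [h'] at h
      rw [show e' c = 0 by simpa using h]
      simp
  | prev c k =>
    obtain ⟨rfl, h0, h1, h⟩ := h
    have h2 : Nat.log 2 (e c) = Nat.log 2 (e' c) + 1 := by
      rw [h1, mul_comm, Nat.log_mul_base (by norm_num) (by omega)]
    have h3 : ∑ c ∈ P.clk, Nat.log 2 (e' c) < ∑ c ∈ P.clk, Nat.log 2 (e c) := by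
      refine Finset.sum_lt_sum (fun d _ => ?_) ⟨c, hφ, by omega⟩
      by_cases hd : d = c
      · subst hd; omega
      · rw [h d hd]
    have h4 := P.rank_lt_tick k
    have h5 := Nat.mul_le_mul_left P.tick (Nat.succ_le_of_lt h3)
    rw [Nat.mul_succ] at h5
    simp only [level, lev]
    omega
  | rel k =>
    obtain ⟨rfl, h⟩ := h
    exact key (fun c _ => by rw [h c]) (P.lev_lt k)

/-- The circuits for a program. -/
def spec : GateSpec F where
  Tag := {φ // φ ∈ P.gates}
  finTag := P.finite_gates
  root := ⟨rel P.out, P.rel_mem _⟩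
  kind φ := φ.1.kind
  low φ := φ.1.low
  rel φ χ s n e e' := Feeds P.body s n e e' φ.1 χ.1
  automatic φ χ := automatic_feeds P.body φ.1 χ.1
  level φ e := P.level φ.1 e
  level_lt φ χ _ _ _ _ _ _ _ h := P.level_lt (P.wf_of_mem φ.2) h
  not_unary := by
    rintro ⟨φ, hφ⟩ s n e hk he
    cases φ with
    | neg φ =>
      refine ⟨⟨⟨φ, P.part_mem hφ rfl⟩, e⟩, ⟨he, rfl, fun _ => rfl⟩, ?_⟩
      rintro ⟨⟨χ, hχ⟩, e'⟩ ⟨-, h1, h2⟩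
      obtain rfl : χ = φ := h1
      obtain rfl : e' = e := funext h2
      rfl
    | _ => simp [kind] at hk

theorem log_le_log_of_bdd {n m : ℕ} (h : m < 2 ^ Nat.size n) : Nat.log 2 m ≤ Nat.log 2 n := by
  rcases Nat.eq_zero_or_pos m with rfl | hm
  · simp
  · exact Nat.le_log_of_pow_le (by norm_num)
      (Nat.lt_size.1 (Nat.log_lt_of_lt_pow hm.ne' h))

theorem bdd_update {s : ℕ} {e : Fin F → ℕ} (he : Bdd s e) (i : Fin F) {a : ℕ} (ha : a < 2 ^ s) :
    Bdd s (Function.update e i a) := by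
  intro j
  by_cases h : j = i
  · subst h; simpa
  · simpa [h] using he j

theorem bdd_src {s : ℕ} (hs : 0 < s) {e : Fin F → ℕ} (he : Bdd s e) (σ : Fin F → Src F) :
    Bdd s (fun j => (σ j).val s e) := by
  intro j
  dsimp only
  cases σ j with
  | reg i => exact he i
  | zero => simp [Src.val]
  | top => exact Nat.pow_lt_pow_right (by norm_num) (by omega)

/-- The gates for a formula compute its truth value. -/
theorem value_iff_sem {n : ℕ} (hn : 0 < n) {x : ℕ → Prop} {v : P.spec.Tag → (Fin F → ℕ) → Prop}
    (hv : ∀ τ e, Bdd (Nat.size n) e → P.spec.GateEq n x v τ e) (φ : Form F P.R)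
    (hφ : φ ∈ P.gates) (e : Fin F → ℕ) (he : Bdd (Nat.size n) e) :
    v ⟨φ, hφ⟩ e ↔ φ.sem (Nat.size n) n x (fun k => v ⟨rel k, P.rel_mem k⟩) e := by
  have hs : 0 < Nat.size n := Nat.size_pos.2 hn
  have htru : ∀ e, Bdd (Nat.size n) e → v ⟨tru, P.tru_mem⟩ e := fun e he =>
    (hv ⟨tru, P.tru_mem⟩ e he).2 fun _ _ _ h => absurd h id
  induction φ generalizing e with
  | tru => exact iff_of_true (htru e he) trivial
  | inp r => exact hv ⟨_, hφ⟩ e he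
  | lt i j =>
    refine (show _ ↔ _ from hv ⟨_, hφ⟩ e he).trans ⟨?_, fun h => ?_⟩
    · rintro ⟨⟨χ, hχ⟩, e', -, ⟨-, h, -⟩, -⟩; exact h
    · exact ⟨⟨tru, P.tru_mem⟩, e, he, ⟨rfl, h, fun _ => rfl⟩, htru e he⟩
  | neg φ ih =>
    have hφ' : φ ∈ P.gates := P.part_mem hφ rfl
    refine (show _ ↔ _ from hv ⟨_, hφ⟩ e he).trans ⟨?_, fun h => ?_⟩
    · rintro ⟨⟨χ, hχ⟩, e', -, ⟨h1, h2⟩, h⟩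
      obtain rfl : χ = φ := h1
      obtain rfl : e' = e := funext h2
      exact fun h' => h ((ih hχ e' he).2 h')
    · exact ⟨⟨φ, hφ'⟩, e, he, ⟨rfl, fun _ => rfl⟩, fun h' => h ((ih hφ' e he).1 h')⟩
  | conj φ ψ ih ih' =>
    have hφ' : φ ∈ P.gates := P.part_mem hφ (Or.inl rfl)
    have hψ' : ψ ∈ P.gates := P.part_mem hφ (Or.inr rfl)
    refine (show _ ↔ _ from hv ⟨_, hφ⟩ e he).trans ⟨fun h => ?_, fun h => ?_⟩
    · exact ⟨(ih hφ' e he).1 (h ⟨φ, hφ'⟩ e he ⟨Or.inl rfl, fun _ => rfl⟩),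
        (ih' hψ' e he).1 (h ⟨ψ, hψ'⟩ e he ⟨Or.inr rfl, fun _ => rfl⟩)⟩
    · rintro ⟨χ, hχ⟩ e' - ⟨h1, h2⟩
      obtain rfl : e' = e := funext h2
      rcases h1 with h1 | h1
      · obtain rfl : χ = φ := h1
        exact (ih hχ e' he).2 h.1
      · obtain rfl : χ = ψ := h1
        exact (ih' hχ e' he).2 h.2
  | ex i φ ih =>
    have hφ' : φ ∈ P.gates := P.part_mem hφ rfl
    refine (show _ ↔ _ from hv ⟨_, hφ⟩ e he).trans ⟨?_, ?_⟩
    · rintro ⟨⟨χ, hχ⟩, e', he', ⟨h1, h2, h3⟩, h⟩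
      obtain rfl : χ = φ := h1
      have : e' = Function.update e i (e' i) := by
        funext l
        by_cases hl : l = i
        · subst hl; simp
        · simp [hl, h3 l hl]
      exact ⟨⟨e' i, h2⟩, by rw [← this]; exact (ih hχ e' he').1 h⟩
    · rintro ⟨a, h⟩
      have hb := bdd_update he i (a.2.trans (Nat.lt_size_self n))
      exact ⟨⟨φ, hφ'⟩, _, hb, ⟨rfl, by simp, fun l hl => by simp [hl]⟩,
        (ih hφ' _ hb).2 h⟩
  | sub σ φ ih =>
    have hφ' : φ ∈ P.gates := P.part_mem hφ rfl
    have hb := bdd_src hs he σ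
    refine (show _ ↔ _ from hv ⟨_, hφ⟩ e he).trans ⟨?_, fun h => ?_⟩
    · rintro ⟨⟨χ, hχ⟩, e', he', ⟨h1, h2⟩, h⟩
      obtain rfl : χ = φ := h1
      have : e' = fun j => (σ j).val (Nat.size n) e := by
        funext l
        have := h2 l
        revert this
        cases σ l with
        | reg i => exact id
        | zero => intro h; simpa [Src.val] using h
        | top => exact fun h => h.2
      subst this
      exact (ih hχ _ hb).1 h
    · refine ⟨⟨φ, hφ'⟩, _, hb, ⟨rfl, fun l => ?_⟩, (ih hφ' _ hb).2 h⟩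
      dsimp only
      cases σ l with
      | reg i => rfl
      | zero => simp [Src.val]
      | top => exact ⟨hs, rfl⟩
  | prev c k =>
    refine (show _ ↔ _ from hv ⟨_, hφ⟩ e he).trans ⟨?_, ?_⟩
    · rintro ⟨⟨χ, hχ⟩, e', he', ⟨h1, h2, h3, h4⟩, h⟩
      obtain rfl : χ = rel k := h1
      have : e' = Function.update e c (e' c) := by
        funext l
        by_cases hl : l = c
        · subst hl; simp
        · simp [hl, h4 l hl]
      exact ⟨e' c, h2, h3, by rw [← this]; exact h⟩
    · rintro ⟨a, ha, hc, h⟩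
      refine ⟨⟨rel k, P.rel_mem k⟩, _, bdd_update he c (a := a) ?_,
        ⟨rfl, by simpa using ha, by simpa using hc, fun l hl => by simp [hl]⟩, h⟩
      have := he c
      omega
  | rel k => rfl

/-- A program whose clocks do not tick more than `t n` times is computed by uniform circuits of
depth `O(t n)`. -/
theorem exists_uniformAC (t : ℕ → ℕ) (ht : P.clk = ∅ ∨ ∀ n, Nat.log 2 n ≤ t n) :
    ∃ C : ℕ → Circuit, UniformAC t C ∧ ∀ n, 0 < n → ∀ x, ∃ v : P.R → (Fin F → ℕ) → Prop,
      (∀ k e, Bdd (Nat.size n) e → (v k e ↔ (P.body k).sem (Nat.size n) n x v e)) ∧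
      ∀ e, Bdd (Nat.size n) e → ((C n).output x (pack (Nat.size n) e) ↔ v P.out e) := by
  obtain ⟨B, hB⟩ : ∃ B, ∀ φ ∈ P.gates, φ.lev P.rank ≤ B := by
    obtain ⟨B, hB⟩ := (P.finite_gates.image (lev P.rank)).bddAbove
    exact ⟨B, fun φ hφ => hB ⟨φ, hφ, rfl⟩⟩
  obtain ⟨C, hC, h⟩ := P.spec.exists_uniformAC t (P.tick * P.clk.card + B) (by
    rintro n ⟨φ, hφ⟩ e he
    have h1 : ∑ c ∈ P.clk, Nat.log 2 (e c) ≤ P.clk.card * t n := by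
      rcases ht with ht | ht
      · simp [ht]
      · rw [← smul_eq_mul, ← Finset.sum_const]
        exact Finset.sum_le_sum fun c _ => (log_le_log_of_bdd (he c)).trans (ht n)
    calc P.level φ e ≤ P.tick * (P.clk.card * t n) + B :=
          Nat.add_le_add (Nat.mul_le_mul_left _ h1) (hB φ hφ)
      _ ≤ (P.tick * P.clk.card + B) * t n + (P.tick * P.clk.card + B) := by
          rw [add_mul, mul_assoc]; omega)
  refine ⟨C, hC, fun n hn x => ?_⟩
  obtain ⟨v, hv, hout⟩ := h n x
  refine ⟨fun k => v ⟨rel k, P.rel_mem k⟩, fun k e he => ?_, hout⟩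
  rw [← P.value_iff_sem hn hv (P.body k) (P.body_mem k) e he]
  refine (show _ ↔ _ from hv ⟨rel k, P.rel_mem k⟩ e he).trans ⟨?_, fun h => ?_⟩
  · rintro ⟨⟨χ, hχ⟩, e', -, ⟨h1, h2⟩, h⟩
    obtain rfl : χ = P.body k := h1
    obtain rfl : e' = e := funext h2
    exact h
  · exact ⟨⟨P.body k, P.body_mem k⟩, e, he, ⟨rfl, fun _ => rfl⟩, h⟩

end Program

/-! ### Naming the characters of a finite abelian group -/

namespace Naming

variable {α : Type} [CommGroup α] [LinearOrder α]

/-- The pair `(y, w)` is a power of the pair `(b, v)`. -/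
def Powers (b v y w : α) : Prop := ∃ k : ℕ, y = b ^ k ∧ w = v ^ k

/-- The order of `u` is a multiple of the order of every element. -/
def Dominant (u : α) : Prop := ∀ x y w : α, Powers u x y w ∧ y = 1 → w = 1

/-- The values of the characters: the powers of the least dominant element. -/
def Value (v : α) : Prop := ∃ u, (Dominant u ∧ ∀ u' < u, ¬ Dominant u') ∧ Powers u u v v

/-- The least element outside of `H`. -/
def New {α : Type} [LinearOrder α] (H : α → Prop) (b : α) : Prop := ¬ H b ∧ ∀ b' < b, H b'

/-- The subgroup generated by `H` and the least element outside of it. -/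
def Next (H : α → Prop) (x : α) : Prop :=
  H x ∨ ∃ b x₀ y, New H b ∧ H x₀ ∧ Powers b b y y ∧ x₀ * y = x

/-- The value `z` has the same order as the new element has modulo `H`. -/
def RootCand (H : α → Prop) (z : α) : Prop :=
  Value z ∧ ∃ b, New H b ∧ ∀ y w, Powers b z y w → (H y ↔ w = 1)

/-- The least value that has the same order as the new element has modulo `H`. -/
def Root (H : α → Prop) (z : α) : Prop := RootCand H z ∧ ∀ z' < z, ¬ RootCand H z'

/-- `t` is the least element of its coset of `H`. -/
def Rep (H : α → Prop) (t : α) : Prop := ∀ t' < t, ¬ ∃ k, H k ∧ t' * k = t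

/-- The character of `H` with name `h` can be extended by sending the new element to `v`. -/
def Ext (H : α → Prop) (R : α → α → α → Prop) (h v : α) : Prop :=
  Value v ∧ ∃ b, New H b ∧ ∀ y w, Powers b v y w ∧ H y → R h y w

/-- The least value by which the character of `H` with name `h` can be extended. -/
def LeastExt (H : α → Prop) (R : α → α → α → Prop) (h v : α) : Prop :=
  Ext H R h v ∧ ∀ v' < v, ¬ Ext H R h v'

/-- The coset of `t` is that of a power of the new element, and `d` is the same power of the
root. -/
def Twist (H : α → Prop) (t d : α) : Prop :=
  ∃ b z y k, New H b ∧ Root H z ∧ Powers b z y d ∧ H k ∧ y * k = t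

/-- The character with name `h'` of the next subgroup extends the character of `H` with name `h`
and sends the new element to `v`. -/
def Name (H : α → Prop) (R : α → α → α → Prop) (h' h v : α) : Prop :=
  H h ∧ ∃ t d v₀, Rep H t ∧ h * t = h' ∧ Twist H t d ∧ LeastExt H R h v₀ ∧ v₀ * d = v

/-- The graphs of the characters of the next subgroup, given the graphs `R h` of the characters
of `H` by their names `h`. -/
def NextR (H : α → Prop) (R : α → α → α → Prop) (h' x z : α) : Prop :=
  ((∀ b, ¬ New H b) ∧ R h' x z) ∨ ∃ b h v x₀ z₀ y w, New H b ∧ Name H R h' h v ∧ R h x₀ z₀ ∧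
    Powers b v y w ∧ x₀ * y = x ∧ z₀ * w = z

/-- The increasing chain of subgroups. -/
def chain : ℕ → α → Prop
  | 0 => fun x => x = 1
  | j + 1 => Next (chain j)

/-- The graphs of the characters of the subgroups of the chain, by their names. -/
def graph : ℕ → α → α → α → Prop
  | 0 => fun h x z => h = 1 ∧ x = 1 ∧ z = 1
  | j + 1 => NextR (chain j) (graph j)

/-- The kernel of the character with name `h`. -/
def Kernel (j : ℕ) (h x : α) : Prop := ∃ z, z = 1 ∧ graph j h x z

/-- The kernel of the character with name `h` is a subgroup, as it has to be if `h` is indeed the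
name of a character. -/
def Good (j : ℕ) (h : α) : Prop :=
  (∃ e, e = 1 ∧ Kernel j h e) ∧ ∀ x y z, Kernel j h x ∧ Kernel j h y ∧ x * y = z → Kernel j h z

/-- The table of the kernels of the characters by their names. An element that is not the name of a
character gets the whole group as its kernel. -/
def Table (j : ℕ) (h x : α) : Prop := Kernel j h x ∨ ¬ Good j h

theorem exists_least {β : Type} [LinearOrder β] [Finite β] {p : β → Prop} (h : ∃ x, p x) :
    ∃ x, p x ∧ ∀ y < x, ¬ p y := by
  have := Fintype.ofFinite β
  classical
  obtain ⟨x₀, h₀⟩ := h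
  obtain ⟨x, hx, hmin⟩ := (Finset.univ.filter p).exists_min_image id ⟨x₀, by simpa using h₀⟩
  refine ⟨x, by simpa using hx, fun y hy hp => ?_⟩
  exact absurd (hmin y (by simpa using hp)) (not_le.2 hy)

theorem dominant_iff {α : Type} [CommGroup α] {u : α} :
    Dominant u ↔ ∀ x : α, orderOf x ∣ orderOf u := by
  constructor
  · intro h x
    rw [orderOf_dvd_iff_pow_eq_one]
    exact h x _ _ ⟨⟨orderOf u, rfl, rfl⟩, pow_orderOf_eq_one u⟩
  · rintro h x y w ⟨⟨k, rfl, rfl⟩, hy⟩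
    rw [← orderOf_dvd_iff_pow_eq_one] at hy ⊢
    exact (h x).trans hy

theorem new_unique {β : Type} [LinearOrder β] {H : β → Prop} {b b' : β}
    (h : New H b) (h' : New H b') : b = b' :=
  le_antisymm (not_lt.1 fun hlt => h'.1 (h.2 _ hlt)) (not_lt.1 fun hlt => h.1 (h'.2 _ hlt))

theorem least_unique {β : Type} [LinearOrder β] {p : β → Prop} {x y : β}
    (hx : p x ∧ ∀ z < x, ¬ p z)
    (hy : p y ∧ ∀ z < y, ¬ p z) : x = y :=
  le_antisymm (not_lt.1 fun h => hx.2 _ h hy.1) (not_lt.1 fun h => hy.2 _ h hx.1)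

theorem next_iff {H : Subgroup α} {b : α} (hb : New (· ∈ H) b) (x : α) :
    Next (· ∈ H) x ↔ ∃ x₀ ∈ H, ∃ k : ℕ, x₀ * b ^ k = x := by
  constructor
  · rintro (h | ⟨b', x₀, y, hb', hx₀, ⟨k, rfl, -⟩, rfl⟩)
    · exact ⟨x, h, 0, by simp⟩
    · exact ⟨x₀, hx₀, k, by rw [new_unique hb hb']⟩
  · rintro ⟨x₀, hx₀, k, rfl⟩
    exact Or.inr ⟨b, x₀, b ^ k, hb, hx₀, ⟨k, rfl, rfl⟩, rfl⟩

variable [Finite α]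

/-- The values of the characters form a cyclic group of the largest possible order. -/
theorem exists_value : ∃ u : α, (∀ x : α, orderOf x ∣ orderOf u) ∧
    ∀ v, Value v ↔ ∃ k : ℕ, u ^ k = v := by
  obtain ⟨u₀, hu₀⟩ := Monoid.exists_orderOf_eq_exponent (G := α) Monoid.ExponentExists.of_finite
  obtain ⟨u, hu, hmin⟩ := exists_least (p := Dominant (α := α))
    ⟨u₀, dominant_iff.2 fun x => hu₀ ▸ Monoid.order_dvd_exponent x⟩
  refine ⟨u, dominant_iff.1 hu, fun v => ⟨?_, ?_⟩⟩
  · rintro ⟨u', ⟨h1, h2⟩, k, rfl, -⟩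
    have : u' = u := le_antisymm (not_lt.1 fun h => h2 _ h hu) (not_lt.1 fun h => hmin _ h h1)
    exact ⟨k, by rw [this]⟩
  · rintro ⟨k, rfl⟩
    exact ⟨u, ⟨hu, hmin⟩, k, rfl, rfl⟩

/-- The new element has the same order modulo `H` as some value. -/
theorem exists_rootCand (H : Subgroup α) {b : α} (hb : New (· ∈ H) b) :
    ∃ z, RootCand (· ∈ H) z := by
  obtain ⟨u, hu, hval⟩ := exists_value (α := α)
  set q := orderOf (QuotientGroup.mk b : α ⧸ H) with hq
  have hqu : q ∣ orderOf u := (orderOf_map_dvd (QuotientGroup.mk' H) b).trans (hu b)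
  have hu0 : 0 < orderOf u := orderOf_pos u
  have hz : orderOf (u ^ (orderOf u / q)) = q := orderOf_pow_orderOf_div hu0.ne' hqu
  refine ⟨u ^ (orderOf u / q), (hval _).2 ⟨_, rfl⟩, b, hb, ?_⟩
  rintro y w ⟨k, rfl, rfl⟩
  rw [← orderOf_dvd_iff_pow_eq_one, hz, hq, orderOf_dvd_iff_pow_eq_one, ← QuotientGroup.mk_pow,
    QuotientGroup.eq_one_iff]

theorem exists_new {H : Subgroup α} (h : H ≠ ⊤) : ∃ b, New (· ∈ H) b := by
  obtain ⟨b, hb, hmin⟩ := exists_least (p := fun x => x ∉ H) (by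
    by_contra! hc
    exact h ((Subgroup.eq_top_iff' H).2 hc))
  exact ⟨b, hb, fun y hy => not_not.1 (hmin y hy)⟩

theorem next_eq_sup {H : Subgroup α} {b : α} (hb : New (· ∈ H) b) (x : α) :
    Next (· ∈ H) x ↔ x ∈ H ⊔ Subgroup.zpowers b := by
  rw [next_iff hb, Subgroup.mem_sup]
  constructor
  · rintro ⟨x₀, hx₀, k, h⟩
    exact ⟨x₀, hx₀, b ^ k, ⟨k, by simp⟩, h⟩
  · rintro ⟨x₀, hx₀, y, hy, h⟩
    obtain ⟨k, hk⟩ := mem_powers_iff_mem_zpowers.2 hy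
    exact ⟨x₀, hx₀, k, by rw [← h, ← hk]⟩

/-- In a cyclic group, an element whose order divides that of `z` is a power of `z`. -/
theorem exists_pow_eq {α : Type} [CommGroup α] [Finite α] {u w z : α}
    (hw : ∃ i : ℕ, u ^ i = w) (hz : ∃ i : ℕ, u ^ i = z)
    (h : w ^ orderOf z = 1) : ∃ k : ℕ, z ^ k = w := by
  obtain ⟨i, rfl⟩ := hw
  obtain ⟨j, rfl⟩ := hz
  set g := (orderOf u).gcd j with hg
  have hu : 0 < orderOf u := orderOf_pos u
  have hg0 : 0 < g := Nat.gcd_pos_of_pos_left _ hu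
  have hgi : g ∣ i := by
    rw [orderOf_pow, ← pow_mul, ← orderOf_dvd_iff_pow_eq_one] at h
    obtain ⟨q, hq⟩ : g ∣ orderOf u := Nat.gcd_dvd_left _ _
    rw [← hg, hq, Nat.mul_div_cancel_left _ hg0] at h
    have hq0 : 0 < q := Nat.pos_of_ne_zero (by rintro rfl; omega)
    exact Nat.dvd_of_mul_dvd_mul_right hq0 h
  have hmem : u ^ g ∈ Subgroup.zpowers (u ^ j) := by
    refine ⟨Nat.gcdB (orderOf u) j, ?_⟩
    have := Nat.gcd_eq_gcd_ab (orderOf u) j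
    have h2 : u ^ ((g : ℕ) : ℤ) = u ^ ((orderOf u : ℤ) * Nat.gcdA (orderOf u) j +
        (j : ℤ) * Nat.gcdB (orderOf u) j) := by rw [← this]
    rw [zpow_natCast, zpow_add, zpow_mul, zpow_natCast, pow_orderOf_eq_one, one_zpow, one_mul,
      zpow_mul, zpow_natCast] at h2
    exact h2.symm
  obtain ⟨c, rfl⟩ := hgi
  have := (Subgroup.zpowers (u ^ j)).pow_mem hmem c
  rw [← pow_mul] at this
  exact mem_powers_iff_mem_zpowers.2 this

/-- Every homomorphism that has a name on `H` also has a name on the next subgroup. -/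
theorem exists_name_next {H : Subgroup α} {b : α} (hb : New (· ∈ H) b) (φ : α →* α)
    (hφ : ∀ x, Value (φ x)) {R : α → α → α → Prop} {h : α} (hh : h ∈ H)
    (hR : ∀ x z, R h x z ↔ x ∈ H ∧ z = φ x) :
    ∃ h', Next (· ∈ H) h' ∧
      ∀ x z, NextR (· ∈ H) R h' x z ↔ Next (· ∈ H) x ∧ z = φ x := by
  obtain ⟨u, hu, hval⟩ := exists_value (α := α)
  have hext : ∀ v, Ext (· ∈ H) R h v ↔
      (∃ k : ℕ, u ^ k = v) ∧ ∀ k : ℕ, b ^ k ∈ H → v ^ k = φ b ^ k := by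
    intro v
    rw [Ext, hval]
    refine and_congr_right fun _ => ⟨?_, fun h => ⟨b, hb, ?_⟩⟩
    · rintro ⟨b', hb', h⟩ k hk
      obtain rfl := new_unique hb hb'
      rw [((hR _ _).1 (h _ _ ⟨⟨k, rfl, rfl⟩, hk⟩)).2, map_pow]
    · rintro y w ⟨⟨k, rfl, rfl⟩, hy⟩
      exact (hR _ _).2 ⟨hy, by rw [h k hy, map_pow]⟩
  have hφb : Ext (· ∈ H) R h (φ b) := (hext _).2 ⟨(hval _).1 (hφ b), fun _ _ => rfl⟩
  obtain ⟨v₀, hv₀⟩ := exists_least ⟨_, hφb⟩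
  obtain ⟨z, hz⟩ := exists_least (exists_rootCand H hb)
  have hzb : ∀ k : ℕ, b ^ k ∈ H ↔ z ^ k = 1 := by
    obtain ⟨b', hb', h'⟩ := hz.1.2
    obtain rfl := new_unique hb hb'
    exact fun k => h' _ _ ⟨k, rfl, rfl⟩
  -- the quotient of two admissible values is a power of the root
  obtain ⟨k, hk⟩ : ∃ k : ℕ, v₀ * z ^ k = φ b := by
    obtain ⟨⟨i, hi⟩, hv₀'⟩ := (hext v₀).1 hv₀.1
    obtain ⟨i', hi'⟩ := (hval _).1 (hφ b)
    have hw : ∃ i : ℕ, u ^ i = φ b * v₀⁻¹ := by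
      have : φ b * v₀⁻¹ ∈ Subgroup.zpowers u :=
        mul_mem ⟨i', by simpa using hi'⟩ (inv_mem ⟨i, by simpa using hi⟩)
      exact mem_powers_iff_mem_zpowers.2 this
    have hq : (φ b * v₀⁻¹) ^ orderOf z = 1 := by
      have h1 : b ^ orderOf z ∈ H := (hzb _).2 (pow_orderOf_eq_one z)
      rw [mul_pow, inv_pow, hv₀' _ h1, mul_inv_cancel]
    obtain ⟨k, hk⟩ := exists_pow_eq hw ((hval z).1 hz.1.1) hq
    exact ⟨k, by rw [hk, mul_comm, inv_mul_cancel_right]⟩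
  -- the least element of the coset of `b ^ k`
  obtain ⟨t, ⟨m, hm, ht⟩, htmin⟩ := exists_least (p := fun t => ∃ m ∈ H, b ^ k * m = t)
    ⟨b ^ k, 1, H.one_mem, mul_one _⟩
  have hrep : Rep (· ∈ H) t := by
    rintro t' ht' ⟨m', hm', hmt⟩
    refine htmin t' ht' ⟨m * m'⁻¹, H.mul_mem hm (H.inv_mem hm'), ?_⟩
    rw [← mul_assoc, ht, ← hmt, mul_inv_cancel_right]
  have htwist : ∀ d, Twist (· ∈ H) t d ↔ d = z ^ k := by
    intro d
    constructor
    · rintro ⟨b', z', y, m', hb', hz', ⟨k', rfl, rfl⟩, hm', ht'⟩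
      obtain rfl := new_unique hb hb'
      obtain rfl : z = z' := least_unique hz hz'
      have key : ∀ i j m m', m ∈ H → m' ∈ H → b ^ i * m = b ^ j * m' → i ≤ j → z ^ i = z ^ j := by
        intro i j m m' hm hm' h hij
        obtain ⟨d, rfl⟩ := Nat.exists_eq_add_of_le hij
        rw [pow_add, mul_assoc] at h
        have hd : b ^ d ∈ H := by
          rw [← mul_inv_eq_of_eq_mul (mul_left_cancel h)]
          exact H.mul_mem hm (H.inv_mem hm')
        rw [pow_add, (hzb d).1 hd, mul_one]
      rcases le_total k k' with hle | hle
      · exact (key _ _ _ _ hm hm' (ht.trans ht'.symm) hle).symm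
      · exact key _ _ _ _ hm' hm (ht'.trans ht.symm) hle
    · rintro rfl
      exact ⟨b, z, b ^ k, m, hb, hz, ⟨k, rfl, rfl⟩, hm, ht⟩
  have hname : ∀ h₁ v, Name (· ∈ H) R (h * t) h₁ v ↔ h₁ = h ∧ v = φ b := by
    intro h₁ v
    constructor
    · rintro ⟨hh₁, t₁, d, v₁, hrep₁, he, htw, hle, rfl⟩
      have h3 : t₁ = t := by
        refine le_antisymm (not_lt.1 fun hlt => hrep₁ t hlt ⟨h * h₁⁻¹, ?_, ?_⟩)
          (not_lt.1 fun hlt => hrep t₁ hlt ⟨h₁ * h⁻¹, ?_, ?_⟩)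
        · exact H.mul_mem hh (H.inv_mem hh₁)
        · rw [← mul_assoc, mul_inv_eq_iff_eq_mul, mul_comm, ← he, mul_comm]
        · exact H.mul_mem hh₁ (H.inv_mem hh)
        · rw [← mul_assoc, mul_inv_eq_iff_eq_mul, mul_comm, he, mul_comm]
      subst h3
      obtain rfl : h₁ = h := mul_right_cancel he
      rw [(htwist d).1 htw, least_unique hle hv₀]
      exact ⟨rfl, hk⟩
    · rintro ⟨rfl, rfl⟩
      exact ⟨hh, t, z ^ k, v₀, hrep, rfl, (htwist _).2 rfl, hv₀, hk⟩
  refine ⟨h * t, (next_iff hb _).2 ⟨h * m, H.mul_mem hh hm, k, ?_⟩, fun x y => ?_⟩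
  · rw [← ht, mul_assoc, mul_comm m]
  · rw [next_iff hb]
    constructor
    · rintro (⟨h1, -⟩ | ⟨b', h₁, v, x₀, z₀, y₁, w, hb', hn, hr, ⟨i, rfl, rfl⟩, rfl, rfl⟩)
      · exact absurd hb (h1 b)
      · obtain ⟨rfl, rfl⟩ := (hname _ _).1 hn
        obtain ⟨hx₀, rfl⟩ := (hR _ _).1 hr
        obtain rfl := new_unique hb hb'
        exact ⟨⟨x₀, hx₀, i, rfl⟩, by rw [map_mul, map_pow]⟩
    · rintro ⟨⟨x₀, hx₀, i, rfl⟩, rfl⟩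
      exact Or.inr ⟨b, h, φ b, x₀, φ x₀, b ^ i, φ b ^ i, hb, (hname _ _).2 ⟨rfl, rfl⟩,
        (hR _ _).2 ⟨hx₀, rfl⟩, ⟨i, rfl, rfl⟩, rfl, by rw [map_mul, map_pow]⟩

/-- The members of the chain are subgroups that at least double in size until they are everything,
and all homomorphisms have names on them. -/
theorem exists_name (j : ℕ) : ∃ H : Subgroup α, (∀ x, chain j x ↔ x ∈ H) ∧
    (H = ⊤ ∨ 2 ^ j ≤ Nat.card H) ∧ ∀ φ : α →* α, (∀ x, Value (φ x)) →
      ∃ h ∈ H, ∀ x z, graph j h x z ↔ x ∈ H ∧ z = φ x := by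
  induction j with
  | zero =>
    refine ⟨⊥, fun x => by simp [chain, Subgroup.mem_bot], Or.inr (by simp), fun φ _ =>
      ⟨1, Subgroup.one_mem _, fun x z => ?_⟩⟩
    simp only [graph, true_and, Subgroup.mem_bot]
    refine and_congr_right ?_
    rintro rfl
    rw [map_one]
  | succ j ih =>
    obtain ⟨H, hH, hcard, hname⟩ := ih
    have hH' : chain j = (· ∈ H) := funext fun x => propext (hH x)
    by_cases htop : H = ⊤
    · subst htop
      have hnew : ∀ b : α, ¬ New (· ∈ (⊤ : Subgroup α)) b := fun b hb => hb.1 trivial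
      refine ⟨⊤, fun x => ?_, Or.inl rfl, fun φ hφ => ?_⟩
      · simp only [chain, hH']
        exact iff_of_true (Or.inl trivial) trivial
      · obtain ⟨h, hh, hR⟩ := hname φ hφ
        refine ⟨h, hh, fun x z => ?_⟩
        rw [← hR]
        simp only [graph, hH', NextR]
        exact ⟨fun h => h.elim (fun h => h.2) fun ⟨b, _, _, _, _, _, _, hb, _⟩ =>
          absurd hb (hnew b), fun h => Or.inl ⟨hnew, h⟩⟩
    · obtain ⟨b, hb⟩ := exists_new htop
      refine ⟨H ⊔ Subgroup.zpowers b, fun x => ?_, Or.inr ?_, fun φ hφ => ?_⟩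
      · simp only [chain, hH']
        exact next_eq_sup hb x
      · have hle : H ≤ H ⊔ Subgroup.zpowers b := le_sup_left
        have hne : Nat.card H ≠ Nat.card ↥(H ⊔ Subgroup.zpowers b) := by
          intro h
          have := Subgroup.eq_of_le_of_card_ge hle h.ge
          refine hb.1 ?_
          change b ∈ H
          rw [this]
          exact Subgroup.mem_sup_right (Subgroup.mem_zpowers b)
        obtain ⟨c, hc⟩ := Subgroup.card_dvd_of_le hle
        have h2 : 2 ≤ c := by
          have : 0 < Nat.card ↥(H ⊔ Subgroup.zpowers b) := Nat.card_pos
          rcases c with _ | _ | c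
          · omega
          · omega
          · omega
        rw [hc, pow_succ]
        exact Nat.mul_le_mul (hcard.resolve_left htop) h2
      · obtain ⟨h, hh, hR⟩ := hname φ hφ
        obtain ⟨h', hh', hR'⟩ := exists_name_next hb φ hφ hh hR
        refine ⟨h', (next_eq_sup hb h').1 hh', fun x z => ?_⟩
        rw [← next_eq_sup hb]
        simp only [graph, hH']
        exact hR' x z

/-- The homomorphisms with values in the powers of the least dominant element separate subgroups
from elements. -/
theorem exists_hom (K : Subgroup α) {g : α} (hg : g ∉ K) :
    ∃ φ : α →* α, (∀ x, Value (φ x)) ∧ (∀ x ∈ K, φ x = 1) ∧ φ g ≠ 1 := by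
  obtain ⟨u, hu, hval⟩ := exists_value (α := α)
  have hg' : (QuotientGroup.mk g : α ⧸ K) ≠ 1 := by rwa [Ne, QuotientGroup.eq_one_iff]
  obtain ⟨ψ, hψ⟩ := CommGroup.exists_apply_ne_one_of_hasEnoughRootsOfUnity (α ⧸ K) ℂ hg'
  have hne : NeZero (orderOf u) := ⟨(orderOf_pos u).ne'⟩
  have hroot : ∀ x : α, ψ (QuotientGroup.mk x) ∈ rootsOfUnity (orderOf u) ℂ := by
    intro x
    rw [mem_rootsOfUnity, ← map_pow, ← QuotientGroup.mk_pow,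
      orderOf_dvd_iff_pow_eq_one.1 (hu x), QuotientGroup.mk_one, map_one]
  let χ : α →* rootsOfUnity (orderOf u) ℂ :=
    (ψ.comp (QuotientGroup.mk' K)).codRestrict _ hroot
  have hcard : Nat.card (rootsOfUnity (orderOf u) ℂ) = Nat.card (Subgroup.zpowers u) := by
    rw [Nat.card_zpowers, Complex.card_rootsOfUnity]
  let E : rootsOfUnity (orderOf u) ℂ ≃* Subgroup.zpowers u := mulEquivOfCyclicCardEq hcard
  have hφ : ∀ x, (E (χ x) : α) = 1 ↔ ψ (QuotientGroup.mk x) = 1 := by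
    intro x
    rw [OneMemClass.coe_eq_one, map_eq_one_iff E E.injective, ← OneMemClass.coe_eq_one]
    rfl
  refine ⟨(Subgroup.zpowers u).subtype.comp (E.toMonoidHom.comp χ), fun x => ?_, fun x hx => ?_, ?_⟩
  · exact (hval _).2 (mem_powers_iff_mem_zpowers.2 (E (χ x)).2)
  · exact (hφ x).2 (by rw [(QuotientGroup.eq_one_iff x).2 hx, map_one])
  · exact fun h => hψ ((hφ g).1 h)

/-- The table of kernels decides membership in the subgroup generated by a set. -/
theorem mem_closure_iff {j : ℕ} (hj : Nat.card α < 2 ^ (j + 1)) (S : Set α) (g : α) :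
    g ∈ Subgroup.closure S ↔ ∀ h, (∀ x ∈ S, Table j h x) → Table j h g := by
  constructor
  · intro hg h hS
    by_cases hgood : Good j h
    · have hS' : ∀ x ∈ S, Kernel j h x := fun x hx => (hS x hx).resolve_right (not_not.2 hgood)
      obtain ⟨⟨_, rfl, hone⟩, hmul⟩ := hgood
      let N : Submonoid α :=
        { carrier := {x | Kernel j h x}
          one_mem' := hone
          mul_mem' := fun {x y} hx hy => hmul x y _ ⟨hx, hy, rfl⟩ }
      let N' : Subgroup α :=
        { N with
          inv_mem' := fun {x} hx => by
            have h1 : x⁻¹ ∈ Subgroup.zpowers x := Subgroup.inv_mem _ (Subgroup.mem_zpowers x)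
            obtain ⟨k, hk⟩ := mem_powers_iff_mem_zpowers.2 h1
            have h2 : x ^ k ∈ N := N.pow_mem hx k
            rw [show x ^ k = x⁻¹ from hk] at h2
            exact h2 }
      exact Or.inl ((Subgroup.closure_le N').2 hS' hg)
    · exact Or.inr hgood
  · intro h
    by_contra hg
    obtain ⟨φ, hval, hS, hφ⟩ := exists_hom _ hg
    obtain ⟨H, -, hcard, hname⟩ := exists_name (α := α) j
    have htop : H = ⊤ := by
      refine hcard.elim id fun hle => Subgroup.eq_top_of_card_eq H ?_
      obtain ⟨c, hc⟩ := Subgroup.card_subgroup_dvd_card H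
      have hpos : 0 < Nat.card α := Nat.card_pos
      rcases c with _ | _ | c
      · omega
      · omega
      · have : Nat.card H * 2 ≤ Nat.card H * (c + 1 + 1) := Nat.mul_le_mul_left _ (by omega)
        rw [pow_succ] at hj
        omega
    obtain ⟨a, -, ha⟩ := hname φ hval
    have hker : ∀ x, Kernel j a x ↔ φ x = 1 := by
      intro x
      simp only [Kernel, exists_eq_left, ha, htop, Subgroup.mem_top, true_and]
      exact eq_comm
    have hgood : Good j a := by
      refine ⟨⟨1, rfl, (hker 1).2 (map_one φ)⟩, ?_⟩
      rintro x y z ⟨hx, hy, rfl⟩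
      rw [hker] at hx hy ⊢
      rw [map_mul, hx, hy, one_mul]
    have := h a fun x hx => Or.inl ((hker x).2 (hS x (Subgroup.subset_closure hx)))
    exact hφ ((hker g).1 (this.resolve_right (not_not.2 hgood)))

end Naming

/-! ### Derived connectives -/

namespace Form

variable {F : ℕ} {R : Type}

/-- Disjunction. -/
def disj (φ ψ : Form F R) : Form F R := neg (conj (neg φ) (neg ψ))

/-- Implication. -/
def imp (φ ψ : Form F R) : Form F R := neg (conj φ (neg ψ))

/-- Universal quantification. -/
def all (i : Fin F) (φ : Form F R) : Form F R := neg (ex i (neg φ))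

/-- Equality of registers. -/
def eq (i j : Fin F) : Form F R := conj (neg (lt i j)) (neg (lt j i))

/-- A substitution that fills the registers, except the clocks `10` and `11`, from a list. -/
def args (c : Fin 12 → Src 12) (l : List (Src 12)) (j : Fin 12) : Src 12 :=
  if j = 10 ∨ j = 11 then c j else l.getD j .zero

/-- The relation `k` for the contents of the registers in the list. -/
def call (k : R) (l : List (Fin 12)) : Form 12 R := sub (args .reg (l.map .reg)) (rel k)

/-- The bit of the input stream `r` whose number is the concatenation of the registers in the
list. -/
def bit (r : Fin 4) (l : List (Fin 12)) : Form 12 R :=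
  sub (args (fun _ => .zero) (l.map .reg)) (inp r)

end Form

open Form

/-- Registers with two clocks and a list of values. -/
def regs (c₁ c₂ : ℕ) (l : List ℕ) (j : Fin 12) : ℕ :=
  if j = 10 then c₁ else if j = 11 then c₂ else l.getD j 0

theorem args_val (s : ℕ) (e : Fin 12 → ℕ) (c : Fin 12 → Src 12) (l : List (Src 12)) :
    (fun j => (args c l j).val s e) =
      regs ((c 10).val s e) ((c 11).val s e) (l.map (Src.val s e)) := by
  funext j
  unfold args regs
  by_cases h : j = 10
  · subst h; simp
  · by_cases h' : j = 11
    · subst h'; simp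
    · simp only [h, h', or_self, if_false, List.getD_eq_getElem?_getD, List.getElem?_map]
      cases l[(j : ℕ)]? <;> rfl

theorem update_regs_10 (c₁ c₂ a : ℕ) (l : List ℕ) :
    Function.update (regs c₁ c₂ l) 10 a = regs a c₂ l := by
  funext j
  by_cases h : j = 10
  · subst h; simp [regs]
  · simp [regs, h]

theorem update_regs_11 (c₁ c₂ a : ℕ) (l : List ℕ) :
    Function.update (regs c₁ c₂ l) 11 a = regs c₁ a l := by
  funext j
  by_cases h : j = 11
  · subst h; simp [regs]
  · simp [regs, h]

@[simp]
theorem regs_10 (c₁ c₂ : ℕ) (l : List ℕ) : regs c₁ c₂ l 10 = c₁ := by simp [regs]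

@[simp]
theorem regs_11 (c₁ c₂ : ℕ) (l : List ℕ) : regs c₁ c₂ l 11 = c₂ := by simp [regs]

theorem bdd_regs {s c₁ c₂ : ℕ} {l : List ℕ} (h₁ : c₁ < 2 ^ s) (h₂ : c₂ < 2 ^ s)
    (h : ∀ a ∈ l, a < 2 ^ s) : Bdd s (regs c₁ c₂ l) := by
  intro j
  unfold regs
  split_ifs
  · exact h₁
  · exact h₂
  · rw [List.getD_eq_getElem?_getD]
    cases h' : l[(j : ℕ)]? with
    | none => simp
    | some a => exact h a (List.mem_of_getElem? h')

section Sem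

variable {R : Type} (s n : ℕ) (x : ℕ → Prop) (v : R → (Fin 12 → ℕ) → Prop) (e : Fin 12 → ℕ)
  (φ ψ : Form 12 R)

@[simp]
theorem sem_disj : (disj φ ψ).sem s n x v e ↔ φ.sem s n x v e ∨ ψ.sem s n x v e := by
  simp only [disj, sem]; tauto

@[simp]
theorem sem_imp : (imp φ ψ).sem s n x v e ↔ (φ.sem s n x v e → ψ.sem s n x v e) := by
  simp only [imp, sem]; tauto

theorem sem_all (i : Fin 12) : (all i φ).sem s n x v e ↔
    ∀ a : Fin n, φ.sem s n x v (Function.update e i a) := by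
  simp only [all, sem, not_exists, not_not]

@[simp]
theorem sem_eq (i j : Fin 12) : (eq i j : Form 12 R).sem s n x v e ↔ e i = e j := by
  simp only [eq, sem]; omega

@[simp]
theorem sem_call (k : R) (l : List (Fin 12)) :
    (call k l).sem s n x v e ↔ v k (regs (e 10) (e 11) (l.map e)) := by
  simp only [call, sem, args_val, List.map_map]
  rfl

@[simp]
theorem sem_bit (r : Fin 4) (l : List (Fin 12)) :
    (bit r l : Form 12 R).sem s n x v e ↔ x (4 * pack s (regs 0 0 (l.map e)) + r) := by
  simp only [bit, sem, args_val, List.map_map]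
  rfl

@[simp]
theorem sem_prev_one_10 (k : R) (c : ℕ) (l : List ℕ) :
    (prev 10 k).sem s n x v (regs (2 ^ 0) c l) ↔ False := by
  simp only [sem, regs_10, iff_false]
  omega

@[simp]
theorem sem_prev_one_11 (k : R) (c : ℕ) (l : List ℕ) :
    (prev 11 k).sem s n x v (regs c (2 ^ 0) l) ↔ False := by
  simp only [sem, regs_11, iff_false]
  omega

@[simp]
theorem sem_prev_two_pow_10 (k : R) (i c : ℕ) (l : List ℕ) :
    (prev 10 k).sem s n x v (regs (2 ^ (i + 1)) c l) ↔ v k (regs (2 ^ i) c l) := by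
  simp only [sem, regs_10, update_regs_10, pow_succ']
  exact ⟨fun ⟨a, _, h, hv⟩ => Nat.eq_of_mul_eq_mul_left two_pos h ▸ hv,
    fun hv => ⟨_, by positivity, rfl, hv⟩⟩

@[simp]
theorem sem_prev_two_pow_11 (k : R) (i c : ℕ) (l : List ℕ) :
    (prev 11 k).sem s n x v (regs c (2 ^ (i + 1)) l) ↔ v k (regs c (2 ^ i) l) := by
  simp only [sem, regs_11, update_regs_11, pow_succ']
  exact ⟨fun ⟨a, _, h, hv⟩ => Nat.eq_of_mul_eq_mul_left two_pos h ▸ hv,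
    fun hv => ⟨_, by positivity, rfl, hv⟩⟩

end Sem

/-! ### The program that tabulates the characters -/

/-- The relation symbols of the program that computes the table of the kernels. The symbol `yes` is
the relation that always holds, so that `prev c yes` tests whether the clock `c` can be halved. -/
inductive InitSym
  | yes
  | pow
  | pow2
  | dominant
  | least
  | value
  | chain
  | new
  | next
  | rootCand
  | root
  | rep
  | graph
  | ext
  | leastExt
  | twist
  | name
  | nextGraph
  | kernel
  | good
  | table
  | out
  deriving DecidableEq

namespace InitSym

instance : Fintype InitSym :=
  ⟨{yes, pow, pow2, dominant, least, value, chain, new, next, rootCand, root, rep, graph, ext,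
    leastExt, twist, name, nextGraph, kernel, good, table, out}, by intro x; cases x <;> simp⟩

/-- The product of the first two registers is the third. -/
def mul (i j k : Fin 12) : Form 12 InitSym := bit 0 [i, j, k]

/-- The register holds the neutral element. -/
def one (i : Fin 12) : Form 12 InitSym := mul i i i

/-- The definitions of the relations. Clock `10` counts the doublings of the exponents of the powers
in `pow` and `pow2`, and clock `11` counts the members of the chain of subgroups. The remaining
relations are those of the same names for the chain of subgroups, as first-order formulas. The
output `out` is the table when register `2` is positive, and the initial generating set otherwise;
register `3` holds zero there. -/
def body : InitSym → Form 12 InitSym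
  | yes => tru
  | pow => disj (conj (neg (prev 10 yes)) (disj (conj (one 2) (one 3)) (conj (eq 2 0) (eq 3 1))))
      (prev 10 pow2)
  | pow2 => ex 4 <| ex 5 <| ex 6 <| ex 7 <| conj (call pow [0, 1, 4, 5]) <|
      conj (call pow [0, 1, 6, 7]) <| conj (mul 4 6 2) (mul 5 7 3)
  | dominant => all 1 <| all 2 <| all 3 <| imp (conj (call pow2 [0, 1, 2, 3]) (one 2)) (one 3)
  | least => conj (call dominant [0]) <| all 1 <| imp (lt 1 0) (neg (call dominant [1]))
  | value => ex 1 <| conj (call least [1]) (call pow2 [1, 1, 0, 0])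
  | chain => disj (conj (neg (prev 11 yes)) (one 0)) (prev 11 next)
  | new => conj (neg (call chain [0])) <| all 1 <| imp (lt 1 0) (call chain [1])
  | next => disj (call chain [0]) <| ex 1 <| ex 2 <| ex 3 <| conj (call new [1]) <|
      conj (call chain [2]) <| conj (call pow2 [1, 1, 3, 3]) (mul 2 3 0)
  | rootCand => conj (call value [0]) <| ex 1 <| conj (call new [1]) <| all 2 <| all 3 <|
      imp (call pow2 [1, 0, 2, 3])
        (conj (imp (call chain [2]) (one 3)) (imp (one 3) (call chain [2])))
  | root => conj (call rootCand [0]) <| all 1 <| imp (lt 1 0) (neg (call rootCand [1]))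
  | rep => all 1 <| imp (lt 1 0) <| neg <| ex 2 <| conj (call chain [2]) (mul 1 2 0)
  | graph => disj (conj (neg (prev 11 yes)) <| conj (one 0) <| conj (one 1) (one 2))
      (prev 11 nextGraph)
  | ext => conj (call value [1]) <| ex 2 <| conj (call new [2]) <| all 3 <| all 4 <|
      imp (conj (call pow2 [2, 1, 3, 4]) (call chain [3])) (call graph [0, 3, 4])
  | leastExt => conj (call ext [0, 1]) <| all 2 <| imp (lt 2 1) (neg (call ext [0, 2]))
  | twist => ex 2 <| ex 3 <| ex 4 <| ex 5 <| conj (call new [2]) <| conj (call root [3]) <|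
      conj (call pow2 [2, 3, 4, 1]) <| conj (call chain [5]) (mul 4 5 0)
  | name => conj (call chain [1]) <| ex 3 <| ex 4 <| ex 5 <| conj (call rep [3]) <|
      conj (mul 1 3 0) <| conj (call twist [3, 4]) <| conj (call leastExt [1, 5]) (mul 5 4 2)
  | nextGraph => disj (conj (all 3 (neg (call new [3]))) (call graph [0, 1, 2])) <|
      ex 3 <| ex 4 <| ex 5 <| ex 6 <| ex 7 <| ex 8 <| ex 9 <| conj (call new [3]) <|
      conj (call name [0, 4, 5]) <| conj (call graph [4, 6, 7]) <| conj (call pow2 [3, 5, 8, 9]) <|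
      conj (mul 6 8 1) (mul 7 9 2)
  | kernel => ex 2 <| conj (one 2) (call graph [0, 1, 2])
  | good => conj (ex 1 <| conj (one 1) (call kernel [0, 1])) <| all 1 <| all 2 <| all 3 <|
      imp (conj (call kernel [0, 1]) <| conj (call kernel [0, 2]) (mul 1 2 3)) (call kernel [0, 3])
  | table => disj (call kernel [0, 1]) (neg (call good [0]))
  | out => disj (conj (lt 3 2) (call table [1, 0])) (conj (neg (lt 3 2)) (bit 1 [0]))

/-- The order in which the relations are computed between two ticks of the clocks. -/
def order : InitSym → ℕ
  | yes => 1
  | pow => 2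
  | pow2 => 3
  | dominant => 4
  | least => 5
  | value => 6
  | chain => 7
  | new => 8
  | next => 9
  | rootCand => 10
  | root => 11
  | rep => 12
  | graph => 13
  | ext => 14
  | leastExt => 15
  | twist => 16
  | name => 17
  | nextGraph => 18
  | kernel => 19
  | good => 20
  | table => 21
  | out => 22

theorem wf_call {clk : Finset (Fin 12)} (h : clk ⊆ {10, 11}) {R : Type} (k : R)
    (l : List (Fin 12)) :
    (call k l).WF clk := by
  refine ⟨fun c hc => Or.inl ?_, trivial⟩
  have := h hc
  simp only [Finset.mem_insert, Finset.mem_singleton] at this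
  simp [args, this]

theorem wf_bit {clk : Finset (Fin 12)} (h : clk ⊆ {10, 11}) {R : Type} (r : Fin 4)
    (l : List (Fin 12)) : (bit r l : Form 12 R).WF clk := by
  refine ⟨fun c hc => Or.inr ?_, trivial⟩
  have := h hc
  simp only [Finset.mem_insert, Finset.mem_singleton] at this
  simp [args, this]

/-- The program that initializes the memory. Each formula adds depth less than `40` to
that of the relations that it calls. -/
def program : Program 12 where
  R := InitSym
  fintypeR := inferInstance
  body := body
  out := out
  clk := {10, 11}
  rank k := 40 * k.order
  wf k := by
    have h := fun k l => wf_call (clk := {10, 11}) subset_rfl (R := InitSym) k l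
    have h' := fun r l => wf_bit (clk := {10, 11}) subset_rfl (R := InitSym) r l
    cases k <;> simp [body, WF, h, h', disj, imp, all, eq, one, mul]
  lev_lt k := by
    cases k <;> simp [body, lev, disj, imp, all, eq, one, mul, call, bit, order]

end InitSym

/-! ### Correctness of the table -/

/-- The elements of a group on `Fin n`, apart from the ring structure of `Fin n`. -/
def GroupOf {n : ℕ} (_G : CommGroup (Fin n)) : Type := Fin n

namespace GroupOf

variable {n : ℕ} {G : CommGroup (Fin n)}

instance : CommGroup (GroupOf G) := G

instance : LinearOrder (GroupOf G) := inferInstanceAs (LinearOrder (Fin n))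

instance : Finite (GroupOf G) := inferInstanceAs (Finite (Fin n))

/-- An element as a member of `Fin n`. -/
def toFin (a : GroupOf G) : Fin n := a

/-- The number of an element. -/
def val (a : GroupOf G) : ℕ := Fin.val a

theorem val_lt (a : GroupOf G) : a.val < 2 ^ Nat.size n := a.isLt.trans (Nat.lt_size_self n)

theorem val_inj {a b : GroupOf G} : a.val = b.val ↔ a = b := Fin.val_inj

theorem val_lt_val {a b : GroupOf G} : a.val < b.val ↔ a < b := Iff.rfl

theorem size_pos (a : GroupOf G) : 0 < Nat.size n := Nat.size_pos.2 a.toFin.pos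

theorem card : Nat.card (GroupOf G) = n := Nat.card_fin n

end GroupOf

open GroupOf Form

theorem pack_regs_nil (s : ℕ) : pack s (regs 0 0 []) = 0 := by
  simp [pack, regs]

theorem pack_regs_one (s a : ℕ) : pack s (regs 0 0 [a]) = a := by
  simp [pack, Fin.sum_univ_succ, regs]

theorem pack_regs_three (s a b c : ℕ) :
    pack s (regs 0 0 [a, b, c]) = a + 2 ^ s * (b + 2 ^ s * c) := by
  simp [pack, Fin.sum_univ_succ, regs]
  ring

theorem interleave_zero (x y z : ℕ → Prop) (p : ℕ) :
    interleave x y z (4 * p + (0 : Fin 4)) ↔ x p := by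
  simp [interleave]

theorem interleave_one (x y z : ℕ → Prop) (p : ℕ) :
    interleave x y z (4 * p + (1 : Fin 4)) ↔ y p := by
  simp [interleave, show (4 * p + 1) / 4 = p by omega]

theorem interleave_two (x y z : ℕ → Prop) (p : ℕ) :
    interleave x y z (4 * p + (2 : Fin 4)) ↔ z p := by
  simp [interleave, show (4 * p + 2) / 4 = p by omega]

/-- The first digit in base `b` and the rest are unique. -/
theorem digits_unique {b x y x' y' : ℕ} (hx : x < b) (hx' : x' < b)
    (h : x + b * y = x' + b * y') : x = x' ∧ y = y' := by
  have hb : 0 < b := by omega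
  have h1 := congrArg (· % b) h
  have h2 := congrArg (· / b) h
  simp only [Nat.add_mul_mod_self_left, Nat.mod_eq_of_lt hx, Nat.mod_eq_of_lt hx'] at h1
  simp only [Nat.add_mul_div_left _ _ hb, Nat.div_eq_of_lt hx, Nat.div_eq_of_lt hx',
    zero_add] at h2
  exact ⟨h1, h2⟩

theorem tableBits_iff {n : ℕ} {G : CommGroup (Fin n)} (a b c : GroupOf G) :
    tableBits G (pack (Nat.size n) (regs 0 0 [a.val, b.val, c.val])) ↔ a * b = c := by
  rw [pack_regs_three]
  constructor
  · rintro ⟨x, y, z, h, hxyz⟩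
    obtain ⟨h1, h2⟩ := digits_unique a.val_lt (val_lt (G := G) x) h
    obtain ⟨h2, h3⟩ := digits_unique b.val_lt (val_lt (G := G) y) h2
    obtain rfl : a = x := val_inj.1 h1
    obtain rfl : b = y := val_inj.1 h2
    obtain rfl : c = z := Fin.val_injective h3
    exact hxyz
  · exact fun h => ⟨a, b, c, rfl, h⟩

theorem setBits_iff {n : ℕ} {G : CommGroup (Fin n)} (S : Set (Fin n)) (a : GroupOf G) :
    setBits S (pack (Nat.size n) (regs 0 0 [a.val])) ↔ a.toFin ∈ S := by
  rw [pack_regs_one]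
  constructor
  · rintro ⟨x, hx, h⟩
    obtain rfl : x = a := Fin.val_injective h
    exact hx
  · exact fun h => ⟨a, h, rfl⟩

section Lookup

variable (c₁ c₂ a b c d : ℕ) (l : List ℕ)

@[simp]
theorem regs_0 : regs c₁ c₂ (a :: l) 0 = a := rfl

@[simp]
theorem regs_1 : regs c₁ c₂ (a :: b :: l) 1 = b := rfl

@[simp]
theorem regs_2 : regs c₁ c₂ (a :: b :: c :: l) 2 = c := rfl

@[simp]
theorem regs_3 : regs c₁ c₂ (a :: b :: c :: d :: l) 3 = d := rfl

end Lookup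

namespace InitSym

variable {n : ℕ} (G : CommGroup (Fin n)) (S : Set (Fin n))

/-- The input of the circuit that initializes the memory. -/
def input : ℕ → Prop := interleave (tableBits G) (setBits S) fun _ => False

/-- The relations `v` satisfy the defining equations of the program. -/
def Solves (v : InitSym → (Fin 12 → ℕ) → Prop) : Prop :=
  ∀ k e, Bdd (Nat.size n) e → (v k e ↔ (body k).sem (Nat.size n) n (input G S) v e)

variable {G S} {v : InitSym → (Fin 12 → ℕ) → Prop}

@[simp]
theorem input_mul (a b c : GroupOf G) :
    input G S (4 * pack (Nat.size n) (regs 0 0 [a.val, b.val, c.val])) ↔ a * b = c := by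
  rw [← tableBits_iff, ← interleave_zero (tableBits G) (setBits S) fun _ => False, input,
    Fin.val_zero, add_zero]

@[simp]
theorem input_set (a : GroupOf G) :
    input G S (4 * pack (Nat.size n) (regs 0 0 [a.val]) + 1) ↔ a.toFin ∈ S :=
  (interleave_one _ _ _ _).trans (setBits_iff S a)

section Sem

variable {s : ℕ} {x : ℕ → Prop} {e : Fin 12 → ℕ} {φ ψ : Form 12 InitSym}

theorem sem_exists (G : CommGroup (Fin n)) (i : Fin 12) : (ex i φ).sem s n x v e ↔
    ∃ a : GroupOf G, φ.sem s n x v (Function.update e i a.val) := Iff.rfl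

theorem sem_forall (G : CommGroup (Fin n)) (i : Fin 12) : (all i φ).sem s n x v e ↔
    ∀ a : GroupOf G, φ.sem s n x v (Function.update e i a.val) := sem_all ..

@[simp]
theorem sem_neg : (neg φ).sem s n x v e ↔ ¬ φ.sem s n x v e := Iff.rfl

@[simp]
theorem sem_conj : (conj φ ψ).sem s n x v e ↔ φ.sem s n x v e ∧ ψ.sem s n x v e := Iff.rfl

@[simp]
theorem sem_lt (i j : Fin 12) : (lt i j : Form 12 InitSym).sem s n x v e ↔ e i < e j := Iff.rfl

@[simp]
theorem sem_mul (i j k : Fin 12) : (mul i j k).sem s n x v e ↔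
    x (4 * pack s (regs 0 0 [e i, e j, e k])) := by
  simp [mul]

@[simp]
theorem sem_one (i : Fin 12) : (one i).sem s n x v e ↔
    x (4 * pack s (regs 0 0 [e i, e i, e i])) := by
  simp [one]

end Sem

theorem two_pow_lt {i : ℕ} (hi : i < Nat.size n) : 2 ^ i < 2 ^ Nat.size n :=
  Nat.pow_lt_pow_right (by norm_num) hi

namespace Solves

theorem eq (hv : Solves G S v) (k : InitSym) {c₁ c₂ : ℕ} (h₁ : c₁ < 2 ^ Nat.size n)
    (h₂ : c₂ < 2 ^ Nat.size n) (l : List (GroupOf G)) : v k (regs c₁ c₂ (l.map val)) ↔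
      (body k).sem (Nat.size n) n (input G S) v (regs c₁ c₂ (l.map val)) :=
  hv _ _ (bdd_regs h₁ h₂ fun a ha => by obtain ⟨b, -, rfl⟩ := List.mem_map.1 ha; exact b.val_lt)

theorem yes (hv : Solves G S v) {c₁ c₂ : ℕ} (h₁ : c₁ < 2 ^ Nat.size n)
    (h₂ : c₂ < 2 ^ Nat.size n) (l : List (GroupOf G)) : v yes (regs c₁ c₂ (l.map val)) :=
  (hv.eq InitSym.yes h₁ h₂ l).2 trivial

/-- Each tick of clock `10` doubles the bound for the exponents. -/
theorem pow2_of_pow (hv : Solves G S v) {i c : ℕ} (hi : i < Nat.size n) (hc : c < 2 ^ Nat.size n)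
    (hpow : ∀ b z y w : GroupOf G, v pow (regs (2 ^ i) c [b.val, z.val, y.val, w.val]) ↔
      ∃ k ≤ 2 ^ i, y = b ^ k ∧ w = z ^ k) (b z y w : GroupOf G) :
    v pow2 (regs (2 ^ i) c [b.val, z.val, y.val, w.val]) ↔
      ∃ k ≤ 2 ^ (i + 1), y = b ^ k ∧ w = z ^ k := by
  refine (hv.eq pow2 (two_pow_lt hi) hc [b, z, y, w]).trans ?_
  simp [body, sem_exists G, hpow]
  constructor
  · rintro ⟨k, hk, l, hl, rfl, rfl⟩
    exact ⟨k + l, by rw [pow_succ]; omega, (pow_add ..).symm, (pow_add ..).symm⟩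
  · rintro ⟨k, hk, rfl, rfl⟩
    rw [pow_succ] at hk
    refine ⟨k / 2, by omega, k - k / 2, by omega, ?_, ?_⟩ <;>
      rw [← pow_add, Nat.add_sub_cancel' (Nat.div_le_self k 2)]

theorem pow (hv : Solves G S v) {c : ℕ} (hc : c < 2 ^ Nat.size n) (i : ℕ) (hi : i < Nat.size n)
    (b z y w : GroupOf G) : v pow (regs (2 ^ i) c [b.val, z.val, y.val, w.val]) ↔
      ∃ k ≤ 2 ^ i, y = b ^ k ∧ w = z ^ k := by
  refine (hv.eq InitSym.pow (two_pow_lt hi) hc [b, z, y, w]).trans ?_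
  induction i generalizing b z y w with
  | zero =>
    simp only [body, List.map, sem_disj, sem_conj, sem_neg, sem_prev_one_10]
    simp [val_inj, Nat.le_one_iff_eq_zero_or_eq_one, or_and_right, exists_or]
  | succ i ih =>
    have hi' : i < Nat.size n := by omega
    have h1 := hv.yes (two_pow_lt hi') hc [b, z, y, w]
    have h2 := hv.pow2_of_pow hi' hc
      (fun b z y w => (hv.eq InitSym.pow (two_pow_lt hi') hc [b, z, y, w]).trans (ih hi' b z y w))
      b z y w
    simp only [List.map] at h1
    simp only [body, List.map, sem_disj, sem_conj, sem_neg, sem_prev_two_pow_10, h1, h2,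
      not_true, false_and, false_or]

/-- After as many doublings as the number of elements has bits, all exponents are reached. -/
theorem powers (hv : Solves G S v) {c : ℕ} (hc : c < 2 ^ Nat.size n) (b z y w : GroupOf G) :
    v pow2 (regs (2 ^ (Nat.size n - 1)) c [b.val, z.val, y.val, w.val]) ↔
      Naming.Powers b z y w := by
  have hn : 0 < Nat.size n := b.size_pos
  rw [hv.pow2_of_pow (by omega) hc (hv.pow hc _ (by omega)), Nat.sub_add_cancel hn]
  constructor
  · rintro ⟨k, -, h⟩
    exact ⟨k, h⟩
  · rintro ⟨k, rfl, rfl⟩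
    refine ⟨k % Nat.card (GroupOf G), ?_, (pow_mod_natCard b k).symm, (pow_mod_natCard z k).symm⟩
    rw [GroupOf.card]
    exact ((Nat.mod_lt k b.toFin.pos).trans (Nat.lt_size_self n)).le

end Solves

variable (G S v) in
/-- When clock `11` shows `c` and clock `10` its maximum, the computed relations agree with the
subgroup `H` and the graphs `R`. -/
structure At (c : ℕ) (H : GroupOf G → Prop) (R : GroupOf G → GroupOf G → GroupOf G → Prop) :
    Prop where
  solves : Solves G S v
  lt : c < 2 ^ Nat.size n
  chain : ∀ x : GroupOf G, v chain (regs (2 ^ (Nat.size n - 1)) c [x.val]) ↔ H x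
  graph : ∀ h x z : GroupOf G,
    v graph (regs (2 ^ (Nat.size n - 1)) c [h.val, x.val, z.val]) ↔ R h x z

namespace At

variable {c : ℕ} {H : GroupOf G → Prop} {R : GroupOf G → GroupOf G → GroupOf G → Prop}

theorem eq (hv : At G S v c H R) (k : InitSym) (a : GroupOf G) (l : List (GroupOf G)) :
    v k (regs (2 ^ (Nat.size n - 1)) c ((a :: l).map val)) ↔
      (body k).sem (Nat.size n) n (input G S) v
        (regs (2 ^ (Nat.size n - 1)) c ((a :: l).map val)) :=
  hv.solves.eq k (two_pow_lt (Nat.sub_lt a.size_pos one_pos)) hv.lt _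

theorem powers (hv : At G S v c H R) (b z y w : GroupOf G) :
    v pow2 (regs (2 ^ (Nat.size n - 1)) c [b.val, z.val, y.val, w.val]) ↔
      Naming.Powers b z y w := hv.solves.powers hv.lt b z y w

theorem dominant (hv : At G S v c H R) (u : GroupOf G) :
    v InitSym.dominant (regs (2 ^ (Nat.size n - 1)) c [u.val]) ↔ Naming.Dominant u := by
  refine (hv.eq _ u []).trans ?_
  simp [body, sem_forall G, hv.powers, Naming.Dominant]

theorem least (hv : At G S v c H R) (u : GroupOf G) :
    v InitSym.least (regs (2 ^ (Nat.size n - 1)) c [u.val]) ↔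
      Naming.Dominant u ∧ ∀ u' < u, ¬ Naming.Dominant u' := by
  refine (hv.eq _ u []).trans ?_
  simp [body, sem_forall G, hv.dominant, val_lt_val]

theorem value (hv : At G S v c H R) (z : GroupOf G) :
    v InitSym.value (regs (2 ^ (Nat.size n - 1)) c [z.val]) ↔ Naming.Value z := by
  refine (hv.eq _ z []).trans ?_
  simp [body, sem_exists G, hv.least, hv.powers, Naming.Value]

theorem new (hv : At G S v c H R) (b : GroupOf G) :
    v InitSym.new (regs (2 ^ (Nat.size n - 1)) c [b.val]) ↔ Naming.New H b := by
  refine (hv.eq _ b []).trans ?_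
  simp [body, sem_forall G, hv.chain, val_lt_val, Naming.New]

theorem next (hv : At G S v c H R) (x : GroupOf G) :
    v InitSym.next (regs (2 ^ (Nat.size n - 1)) c [x.val]) ↔ Naming.Next H x := by
  refine (hv.eq _ x []).trans ?_
  simp [body, sem_exists G, hv.chain, hv.new, hv.powers, Naming.Next]

theorem rootCand (hv : At G S v c H R) (z : GroupOf G) :
    v InitSym.rootCand (regs (2 ^ (Nat.size n - 1)) c [z.val]) ↔ Naming.RootCand H z := by
  refine (hv.eq _ z []).trans ?_
  simp [body, sem_exists G, sem_forall G, hv.value, hv.new, hv.powers, hv.chain,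
    Naming.RootCand, iff_iff_implies_and_implies]

theorem root (hv : At G S v c H R) (z : GroupOf G) :
    v InitSym.root (regs (2 ^ (Nat.size n - 1)) c [z.val]) ↔ Naming.Root H z := by
  refine (hv.eq _ z []).trans ?_
  simp [body, sem_forall G, hv.rootCand, val_lt_val, Naming.Root]

theorem rep (hv : At G S v c H R) (t : GroupOf G) :
    v InitSym.rep (regs (2 ^ (Nat.size n - 1)) c [t.val]) ↔ Naming.Rep H t := by
  refine (hv.eq _ t []).trans ?_
  simp [body, sem_exists G, sem_forall G, hv.chain, val_lt_val, Naming.Rep]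

theorem ext (hv : At G S v c H R) (h z : GroupOf G) :
    v InitSym.ext (regs (2 ^ (Nat.size n - 1)) c [h.val, z.val]) ↔ Naming.Ext H R h z := by
  refine (hv.eq _ h [z]).trans ?_
  simp [body, sem_exists G, sem_forall G, hv.value, hv.new, hv.powers, hv.chain, hv.graph,
    Naming.Ext]

theorem leastExt (hv : At G S v c H R) (h z : GroupOf G) :
    v InitSym.leastExt (regs (2 ^ (Nat.size n - 1)) c [h.val, z.val]) ↔
      Naming.LeastExt H R h z := by
  refine (hv.eq _ h [z]).trans ?_
  simp [body, sem_forall G, hv.ext, val_lt_val, Naming.LeastExt]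

theorem twist (hv : At G S v c H R) (t d : GroupOf G) :
    v InitSym.twist (regs (2 ^ (Nat.size n - 1)) c [t.val, d.val]) ↔ Naming.Twist H t d := by
  refine (hv.eq _ t [d]).trans ?_
  simp [body, sem_exists G, hv.new, hv.root, hv.powers, hv.chain, Naming.Twist]

theorem name (hv : At G S v c H R) (h' h z : GroupOf G) :
    v InitSym.name (regs (2 ^ (Nat.size n - 1)) c [h'.val, h.val, z.val]) ↔
      Naming.Name H R h' h z := by
  refine (hv.eq _ h' [h, z]).trans ?_
  simp [body, sem_exists G, hv.chain, hv.rep, hv.twist, hv.leastExt, Naming.Name]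

theorem nextGraph (hv : At G S v c H R) (h x z : GroupOf G) :
    v InitSym.nextGraph (regs (2 ^ (Nat.size n - 1)) c [h.val, x.val, z.val]) ↔
      Naming.NextR H R h x z := by
  refine (hv.eq _ h [x, z]).trans ?_
  simp [body, sem_exists G, sem_forall G, hv.new, hv.graph, hv.name, hv.powers, Naming.NextR]

end At

/-- When clock `11` shows `2 ^ j`, the relations describe member `j` of the chain of subgroups. -/
theorem Solves.at (hv : Solves G S v) (j : ℕ) (hj : j < Nat.size n) :
    At G S v (2 ^ j) (Naming.chain j) (Naming.graph j) := by
  have htop : 2 ^ (Nat.size n - 1) < 2 ^ Nat.size n := two_pow_lt (by omega)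
  induction j with
  | zero =>
    refine ⟨hv, two_pow_lt hj, fun x => ?_, fun h x z => ?_⟩
    · refine (hv.eq chain htop (two_pow_lt hj) [x]).trans ?_
      simp only [body, List.map, sem_disj, sem_conj, sem_neg, sem_prev_one_11]
      simp [Naming.chain]
    · refine (hv.eq graph htop (two_pow_lt hj) [h, x, z]).trans ?_
      simp only [body, List.map, sem_disj, sem_conj, sem_neg, sem_prev_one_11]
      simp [Naming.graph]
  | succ j ih =>
    have ih := ih (by omega)
    refine ⟨hv, two_pow_lt hj, fun x => ?_, fun h x z => ?_⟩
    · refine (hv.eq chain htop (two_pow_lt hj) [x]).trans ?_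
      have h1 := hv.yes htop ih.lt [x]
      simp only [List.map] at h1
      simp only [body, List.map, sem_disj, sem_conj, sem_neg, sem_prev_two_pow_11, h1, ih.next,
        not_true, false_and, false_or, Naming.chain]
    · refine (hv.eq graph htop (two_pow_lt hj) [h, x, z]).trans ?_
      have h1 := hv.yes htop ih.lt [h, x, z]
      simp only [List.map] at h1
      simp only [body, List.map, sem_disj, sem_conj, sem_neg, sem_prev_two_pow_11, h1,
        ih.nextGraph, not_true, false_and, false_or, Naming.graph]

namespace At

variable {c j : ℕ}

theorem kernel (hv : At G S v c (Naming.chain j) (Naming.graph j)) (h x : GroupOf G) :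
    v kernel (regs (2 ^ (Nat.size n - 1)) c [h.val, x.val]) ↔ Naming.Kernel j h x := by
  refine (hv.eq _ h [x]).trans ?_
  simp [body, sem_exists G, hv.graph, Naming.Kernel]

theorem good (hv : At G S v c (Naming.chain j) (Naming.graph j)) (h : GroupOf G) :
    v good (regs (2 ^ (Nat.size n - 1)) c [h.val]) ↔ Naming.Good j h := by
  refine (hv.eq _ h []).trans ?_
  simp [body, sem_exists G, sem_forall G, hv.kernel, Naming.Good]

theorem table (hv : At G S v c (Naming.chain j) (Naming.graph j)) (h x : GroupOf G) :
    v table (regs (2 ^ (Nat.size n - 1)) c [h.val, x.val]) ↔ Naming.Table j h x := by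
  refine (hv.eq _ h [x]).trans ?_
  simp [body, hv.kernel, hv.good, Naming.Table]

end At

theorem Solves.out_table (hv : Solves G S v) (h x : GroupOf G) :
    v out (regs (2 ^ (Nat.size n - 1)) (2 ^ (Nat.size n - 1))
      [x.val, h.val, 2 ^ (Nat.size n - 1)]) ↔ Naming.Table (Nat.size n - 1) h x := by
  have hn := Nat.sub_lt h.size_pos one_pos
  have htop := two_pow_lt hn
  rw [hv out _ (bdd_regs htop htop (by simp [val_lt, htop])), ← (hv.at _ hn).table]
  simp [body, regs]

theorem Solves.out_set (hv : Solves G S v) (x : GroupOf G) :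
    v out (regs (2 ^ (Nat.size n - 1)) (2 ^ (Nat.size n - 1)) [x.val]) ↔
      x.toFin ∈ S := by
  have htop := two_pow_lt (Nat.sub_lt x.size_pos one_pos)
  rw [hv out _ (bdd_regs htop htop (by simp [val_lt])), ← input_set x]
  simp [body, regs]

end InitSym

/-! ### The memory, updates and queries -/

/-- The memory holds the table of the kernels and the set `S`. In the addresses, both clocks show
`2 ^ (Nat.size n - 1)`, the final time of the initialization. The table is set apart from the set by
the positive number in register `2`. -/
structure Holds {n : ℕ} (G : CommGroup (Fin n)) (S : Set (Fin n)) (m : ℕ → Prop) : Prop where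
  table : ∀ h x : GroupOf G, m (pack (Nat.size n) (regs (2 ^ (Nat.size n - 1))
    (2 ^ (Nat.size n - 1)) [x.val, h.val, 2 ^ (Nat.size n - 1)])) ↔
      Naming.Table (Nat.size n - 1) h x
  set : ∀ x : GroupOf G, m (pack (Nat.size n) (regs (2 ^ (Nat.size n - 1))
    (2 ^ (Nat.size n - 1)) [x.val])) ↔ x.toFin ∈ S

/-- The new contents of the memory: the table is kept, and the generating set is updated. -/
def updateForm : Form 12 Unit :=
  disj (conj (lt 3 2) (inp 0))
    (conj (neg (lt 3 2)) (conj (disj (inp 0) (bit 1 [0])) (neg (bit 2 [0]))))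

/-- The program that updates the memory. -/
def updateProgram : Program 12 where
  R := Unit
  fintypeR := inferInstance
  body _ := updateForm
  out := ()
  clk := ∅
  rank _ := 40
  wf _ := by simp [updateForm, WF, disj, bit]
  lev_lt _ := by simp [updateForm, lev, disj, bit]

/-- The memory bit for membership of the element in register `i` in the generating set. -/
def memSet (i : Fin 12) : Form 12 Unit := sub (args (fun _ => .top) [.reg i]) (inp 0)

/-- The memory bit for membership of the element in register `i` in the kernel of the character
with its name in register `h`. -/
def memTable (i h : Fin 12) : Form 12 Unit :=
  sub (args (fun _ => .top) [.reg i, .reg h, .top]) (inp 0)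

/-- The answer to a query: the queried element has to be in every kernel that contains the
generating set. -/
def answerForm : Form 12 Unit :=
  all 1 (imp (all 0 (imp (memSet 0) (memTable 0 1)))
    (all 0 (imp (bit 1 [0]) (memTable 0 1))))

/-- The program that answers a query. -/
def answerProgram : Program 12 where
  R := Unit
  fintypeR := inferInstance
  body _ := answerForm
  out := ()
  clk := ∅
  rank _ := 40
  wf _ := by simp [answerForm, WF, all, imp, bit, memSet, memTable]
  lev_lt _ := by simp [answerForm, lev, all, imp, bit, memSet, memTable]

theorem exists_init : ∃ C, UniformAC (fun n => Nat.log 2 n) C ∧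
    ∀ (n : ℕ) (G : CommGroup (Fin n)) (S : Set (Fin n)),
      Holds G S ((C n).output (interleave (tableBits G) (setBits S) fun _ => False)) := by
  obtain ⟨C, hC, h⟩ := InitSym.program.exists_uniformAC _ (Or.inr fun _ => le_rfl)
  refine ⟨C, hC, fun n G S => ?_⟩
  have hn : 0 < n := (toFin (1 : GroupOf G)).pos
  have htop : 2 ^ (Nat.size n - 1) < 2 ^ Nat.size n :=
    InitSym.two_pow_lt (Nat.sub_lt (Nat.size_pos.2 hn) one_pos)
  obtain ⟨v, hv, hout⟩ := h n hn (InitSym.input G S)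
  have hv : InitSym.Solves G S v := hv
  refine ⟨fun h x => ?_, fun x => ?_⟩
  · exact (hout _ (bdd_regs htop htop (by simp [val_lt, htop]))).trans (hv.out_table h x)
  · exact (hout _ (bdd_regs htop htop (by simp [val_lt]))).trans (hv.out_set x)

theorem exists_update : ∃ C, UniformAC (fun _ => 1) C ∧
    ∀ (n : ℕ) (G : CommGroup (Fin n)) (S I D : Set (Fin n)) (m : ℕ → Prop), Holds G S m →
      Holds G ((S ∪ I) \ D) ((C n).output (interleave m (setBits I) (setBits D))) := by
  obtain ⟨C, hC, h⟩ := updateProgram.exists_uniformAC _ (Or.inl rfl)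
  refine ⟨C, hC, fun n G S I D m hm => ?_⟩
  have hn : 0 < n := (toFin (1 : GroupOf G)).pos
  have htop : 2 ^ (Nat.size n - 1) < 2 ^ Nat.size n :=
    InitSym.two_pow_lt (Nat.sub_lt (Nat.size_pos.2 hn) one_pos)
  obtain ⟨v, hv, hout⟩ : ∃ v : Unit → (Fin 12 → ℕ) → Prop,
      (∀ k e, Bdd (Nat.size n) e → (v k e ↔ updateForm.sem (Nat.size n) n
        (interleave m (setBits I) (setBits D)) v e)) ∧
      ∀ e, Bdd (Nat.size n) e → ((C n).output (interleave m (setBits I) (setBits D))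
        (pack (Nat.size n) e) ↔ v () e) := h n hn _
  refine ⟨fun h x => ?_, fun x => ?_⟩
  · have hb := bdd_regs htop htop (l := [x.val, h.val, 2 ^ (Nat.size n - 1)])
      (by simp [val_lt, htop])
    rw [hout _ hb, hv _ _ hb, ← hm.table, ← interleave_zero m (setBits I) (setBits D)]
    simp [updateForm, sem, regs]
  · have hb := bdd_regs htop htop (l := [x.val]) (by simp [val_lt])
    rw [hout _ hb, hv _ _ hb, Set.mem_sdiff, Set.mem_union, ← hm.set, ← setBits_iff I,
      ← setBits_iff D, ← interleave_zero m (setBits I) (setBits D),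
      ← interleave_one m (setBits I) (setBits D),
      ← interleave_two m (setBits I) (setBits D)]
    simp [updateForm, sem, regs]

theorem exists_answer : ∃ C, UniformAC (fun _ => 1) C ∧
    ∀ (n : ℕ) (G : CommGroup (Fin n)) (S : Set (Fin n)) (g : Fin n) (m r : ℕ → Prop),
      Holds G S m →
        ((C n).output (interleave m (setBits {g}) r) 0 ↔ g ∈ generated G S) := by
  obtain ⟨C, hC, h⟩ := answerProgram.exists_uniformAC _ (Or.inl rfl)
  refine ⟨C, hC, fun n G S g m r hm => ?_⟩
  have hn : 0 < n := (toFin (1 : GroupOf G)).pos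
  obtain ⟨v, hv, hout⟩ : ∃ v : Unit → (Fin 12 → ℕ) → Prop,
      (∀ k e, Bdd (Nat.size n) e → (v k e ↔ answerForm.sem (Nat.size n) n
        (interleave m (setBits {g}) r) v e)) ∧
      ∀ e, Bdd (Nat.size n) e → ((C n).output (interleave m (setBits {g}) r)
        (pack (Nat.size n) e) ↔ v () e) := h n hn _
  have hb := bdd_regs (s := Nat.size n) (c₁ := 0) (c₂ := 0) (l := []) (by simp) (by simp) (by simp)
  have hset : ∀ e, (memSet 0).sem (Nat.size n) n (interleave m (setBits {g}) r) v e ↔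
      m (pack (Nat.size n) (regs (2 ^ (Nat.size n - 1)) (2 ^ (Nat.size n - 1)) [e 0])) :=
    fun e => by
    rw [← interleave_zero m (setBits {g}) r]
    simp only [memSet, sem, args_val]
    rfl
  have htable : ∀ e, (memTable 0 1).sem (Nat.size n) n (interleave m (setBits {g}) r) v e ↔
      m (pack (Nat.size n) (regs (2 ^ (Nat.size n - 1)) (2 ^ (Nat.size n - 1))
        [e 0, e 1, 2 ^ (Nat.size n - 1)])) := fun e => by
    rw [← interleave_zero m (setBits {g}) r]
    simp only [memTable, sem, args_val]
    rfl
  have hall : ∀ (i : Fin 12) (φ : Form 12 Unit) (e : Fin 12 → ℕ),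
      (all i φ).sem (Nat.size n) n (interleave m (setBits {g}) r) v e ↔
        ∀ a : GroupOf G, φ.sem (Nat.size n) n (interleave m (setBits {g}) r) v
          (Function.update e i a.val) := fun i φ e => sem_all ..
  have hquery : ∀ a : GroupOf G, interleave m (setBits {g}) r
      (4 * pack (Nat.size n) (regs 0 0 [a.val]) + (1 : Fin 4)) ↔ a = g := fun a => by
    rw [interleave_one, setBits_iff]
    rfl
  rw [← pack_regs_nil (Nat.size n), hout _ hb, hv _ _ hb]
  refine Iff.trans ?_ (Naming.mem_closure_iff (α := GroupOf G) (j := Nat.size n - 1) ?_ S g).symm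
  · simp only [answerForm, hall, sem_imp, hset, htable, sem_bit, List.map, Function.update_self,
      ne_eq, Fin.reduceEq, not_false_eq_true, Function.update_of_ne, hquery, hm.table, hm.set]
    exact forall_congr' fun h => imp_congr_right fun _ => ⟨fun hg => hg _ rfl,
      fun hg _ ha => ha.symm ▸ hg⟩
  · rw [GroupOf.card, Nat.sub_add_cancel (Nat.size_pos.2 hn)]
    exact Nat.lt_size_self n

end DynCGM

theorem mainTheorem2 (c : ℕ) :
    ∃ A : DynCGM.DynAlgorithm, A.IsDynAC0 ∧
      ∀ (n : ℕ) (G : CommGroup (Fin n)) (S₀ : Set (Fin n)) (I D : ℕ → Set (Fin n)),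
        (∀ t, (I t).ncard ≤ c * Nat.log 2 n ^ c + c ∧ (D t).ncard ≤ c * Nat.log 2 n ^ c + c) →
        ∀ t : ℕ,
          (1 - Real.exp (-(n : ℝ))) * 2 ^ A.numCoins n ≤
            ({r : Fin (A.numCoins n) → Bool |
              ∀ g : Fin n, A.Accepts (A.memory G S₀ I D t) g r ↔
                g ∈ DynCGM.generated G (DynCGM.genSet S₀ I D t)}.ncard : ℝ) := by
  obtain ⟨Cinit, hinit, init_holds⟩ := DynCGM.exists_init
  obtain ⟨Cupdate, hupdate, update_holds⟩ := DynCGM.exists_update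
  obtain ⟨Canswer, hanswer, answer_iff⟩ := DynCGM.exists_answer
  refine ⟨⟨Cinit, Cupdate, Canswer, 0⟩, ⟨hinit, hupdate, hanswer⟩, fun n G S₀ I D _ t => ?_⟩
  set A : DynCGM.DynAlgorithm := ⟨Cinit, Cupdate, Canswer, 0⟩
  have hmem : ∀ t, DynCGM.Holds G (DynCGM.genSet S₀ I D t) (A.memory G S₀ I D t) := by
    intro t
    induction t with
    | zero => exact init_holds n G S₀
    | succ t ih => exact update_holds n G _ (I t) (D t) _ ih
  -- the answers do not depend on the random bits
  have hr : {r : Fin (A.numCoins n) → Bool | ∀ g : Fin n,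
      A.Accepts (A.memory G S₀ I D t) g r ↔
        g ∈ DynCGM.generated G (DynCGM.genSet S₀ I D t)} = Set.univ :=
    Set.eq_univ_of_forall fun r g => answer_iff n G _ g _ _ (hmem t)
  rw [hr, Set.ncard_univ,
    Nat.card_fun, Nat.card_eq_fintype_card, Fintype.card_bool, Nat.card_fin, Nat.cast_pow,
    Nat.cast_ofNat]
  exact mul_le_of_le_one_left (by positivity) (by linarith [Real.exp_pos (-(n : ℝ))])
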